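/- **Setting.** Let $X$ be a complex Banach space. For a $\mathcal C_0$-semigroup $S$ on a complex Banach space $E$, let $E^{\odot}=\{\varphi\in E^*: t\mapsto S(t)^*\varphi \text{ is norm continuous on }[0,\infty)\}$, let $S^{\odot}(t)=S(t)^*|_{E^\odot}$, let $S^{\odot*}(t)$ be its adjoint on $E^{\odot*}=(E^{\odot})^*$, and let $E^{\odot\odot}\subseteq E^{\odot*}$ be the subspace on which $S^{\odot*}$ is strongly continuous. Let $j:E\to E^{\odot*}$, $\langle jx,\varphi\rangle=\langle\varphi,x\rangle$; $E$ is $\odot$-reflexive with respect to $S$ if $j(E)=E^{\odot\odot}$. Let $T_0$ be a $\mathcal C_0$-semigroup on $X$ that is eventually compact (that is, $T_0(t_0)$ is compact for some $t_0\ge 0$), and suppose that $X$ is $\odot$-reflexive with respect to $T_0$. Let $p\ge 0$ be an integer, let $L:X\to X^{\odot*}$ be a compact linear operator and let $L_p:\mathbb C^p\to X^{\odot*}$ be linear. Let $T$ be the $\mathcal C_0$-semigroup on $X$ satisfying $$T(t)x=T_0(t)x+j^{-1}\int_0^t T_0^{\odot*}(t-\tau)\,L\,T(\tau)x\,d\tau,\qquad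 t\ge 0,\ x\in X$$ (weak$^\star$ integral). On $\boldsymbol X=X\times\mathbb C^p$ put $\boldsymbol T_0(t)=\operatorname{diag}(T_0(t),I_p)$, identify $\boldsymbol X^{\odot*}$ with $X^{\odot*}\times\mathbb C^p$, and let $\boldsymbol T$ be the $\mathcal C_0$-semigroup on $\boldsymbol X$ obtained in the same way from $\boldsymbol T_0$ and the perturbation $\boldsymbol L(x,\alpha)=(Lx+L_p\alpha,0)$. Let $A$ and $\boldsymbol A$ be the generators of $T$ and $\boldsymbol T$. For an unbounded operator $B$ let $\mathcal M_\lambda(B)=\bigcup_{n}\ker (B-\lambda I)^n$, and let $X_0$ and $\boldsymbol X_0$ be the center eigenspaces of $A$ and $\boldsymbol A$, that is, the linear spans of all $\mathcal M_\lambda(A)$, respectively $\mathcal M_\lambda(\boldsymbol A)$, with $\operatorname{Re}\lambda=0$ ($\lambda=0$ included). **Statement.** The spaces $X^\odot$ for $T_0$ and for $T$ coincide. Let $A^{\odot*}$ be the weak$^\star$ generator of $T^{\odot*}$ on $X^{\odot*}$. All $z\ne0$ sufficiently close to $0$ lie in the resolvent set of $A^{\odot*}$; the residue $$\Gamma_0=\operatorname{Res}_{z=0}\,z^{-1}(zI-A^{\odot*})^{-1}$$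 exists as a bounded operator on $X^{\odot*}$ with range in $j(X)$, and $j^{-1}\Gamma_0:X^{\odot*}\to X$ is bounded. Moreover $$\boldsymbol X_0=X_0\times\{0\}\ \oplus\ \{(j^{-1}\Gamma_0L_p\alpha,\alpha):\alpha\in\mathbb C^p\},\qquad \dim\boldsymbol X_0=\dim X_0+p.$$ -/

import Mathlib

set_option maxSynthPendingDepth 3

open Filter Topology
open scoped NNReal

noncomputable section

/-- A strongly continuous one-parameter semigroup of bounded operators on a complex normed space. -/
structure C0Semigroup (E : Type*) [NormedAddCommGroup E] [NormedSpace ℂ E] where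
  toFun : ℝ≥0 → E →L[ℂ] E
  toFun_zero : toFun 0 = ContinuousLinearMap.id ℂ E
  toFun_add : ∀ s t, toFun (s + t) = (toFun s).comp (toFun t)
  strongly_continuous : ∀ x, Continuous fun t => toFun t x

namespace C0Semigroup

section General

variable {E : Type*} [NormedAddCommGroup E] [NormedSpace ℂ E]

/-- `T t₀` is a compact operator for some `t₀ ≥ 0` (hence `T t` is compact for all `t ≥ t₀`). -/
def IsEventuallyCompact (T : C0Semigroup E) : Prop :=
  ∃ t₀ : ℝ≥0, IsCompactOperator (T.toFun t₀)

/-- The (graph of the) infinitesimal generator: `(x, y)` belongs to it iff `x` is in the domain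
and `y` is the value at `x`, that is, `t⁻¹ (T(t) x - x) → y` in norm as `t ↓ 0`. -/
def generator (T : C0Semigroup E) : Submodule ℂ (E × E) where
  carrier := {q | Tendsto (fun t : ℝ≥0 => ((t : ℝ) : ℂ)⁻¹ • (T.toFun t q.1 - q.1))
    (𝓝[>] 0) (𝓝 q.2)}
  add_mem' := by
    intro a b ha hb
    refine (Tendsto.add ha hb).congr fun t => ?_
    simp only [Prod.fst_add, map_add, ← smul_add]
    congr 1
    abel
  zero_mem' := by simp
  smul_mem' := by
    intro c a ha
    refine (Tendsto.const_smul ha c).congr fun t => ?_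
    simp only [Prod.smul_fst, map_smul, ← smul_sub]
    rw [smul_comm]

/-- The (graph of the) weak-star generator of the adjoint semigroup `T(t)*` on the dual space:
`(Φ, Ψ)` belongs to it iff `t⁻¹ (T(t)* Φ - Φ) → Ψ` in the weak-star sense as `t ↓ 0`. -/
def weakStarGenerator (T : C0Semigroup E) :
    Submodule ℂ (StrongDual ℂ E × StrongDual ℂ E) where
  carrier := {q | ∀ x : E, Tendsto
    (fun t : ℝ≥0 => ((t : ℝ) : ℂ)⁻¹ • (q.1 (T.toFun t x) - q.1 x)) (𝓝[>] 0) (𝓝 (q.2 x))}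
  add_mem' := by
    intro a b ha hb x
    refine (Tendsto.add (ha x) (hb x)).congr fun t => ?_
    simp only [Prod.fst_add, add_apply, ← smul_add]
    congr 1
    abel
  zero_mem' := by intro x; simp
  smul_mem' := by
    intro c a ha x
    refine (Tendsto.const_smul (ha x) c).congr fun t => ?_
    simp only [Prod.smul_fst, smul_apply, ← smul_sub]
    rw [smul_comm]

/-- The sun space `X^⊙`: functionals `φ` whose orbit `t ↦ T(t)* φ = φ ∘ T(t)` is norm
continuous on `[0, ∞)`. -/
def sun (T : C0Semigroup E) : Submodule ℂ (StrongDual ℂ E) where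
  carrier := {φ | Continuous fun t : ℝ≥0 => φ.comp (T.toFun t)}
  add_mem' := by
    intro a b ha hb
    refine (Continuous.add ha hb).congr fun t => ?_
    exact (ContinuousLinearMap.add_comp a b (T.toFun t)).symm
  zero_mem' := by
    simpa using (continuous_const : Continuous fun _ : ℝ≥0 => (0 : StrongDual ℂ E))
  smul_mem' := by
    intro c a ha
    refine (Continuous.const_smul ha c).congr fun t => ?_
    exact (ContinuousLinearMap.smul_comp c a (T.toFun t)).symm

theorem comp_mem_sun (T : C0Semigroup E) (t : ℝ≥0) {φ : StrongDual ℂ E} (hφ : φ ∈ T.sun) :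
    φ.comp (T.toFun t) ∈ T.sun := by
  have h : Continuous fun s : ℝ≥0 => φ.comp (T.toFun s) := hφ
  have h2 : Continuous fun s : ℝ≥0 => φ.comp (T.toFun (t + s)) :=
    h.comp (continuous_const.add continuous_id)
  refine h2.congr fun s => ?_
  rw [T.toFun_add]
  rfl

/-- The sun dual semigroup `T^⊙`: the restriction to `X^⊙` of the adjoint semigroup. -/
def sunSemigroup (T : C0Semigroup E) : C0Semigroup T.sun where
  toFun t := (((ContinuousLinearMap.compL ℂ E E ℂ).flip (T.toFun t)).comp
    T.sun.subtypeL).codRestrict T.sun (fun φ => T.comp_mem_sun t φ.2)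
  toFun_zero := by
    ext φ x
    simp [T.toFun_zero]
  toFun_add := by
    intro s t
    ext φ x
    rw [add_comm s t]
    simp only [T.toFun_add]
    rfl
  strongly_continuous := by
    intro φ
    exact Continuous.subtype_mk φ.2 _

/-- `X^{⊙*}`, the dual of the sun space. -/
abbrev SunStar (T : C0Semigroup E) : Type _ := StrongDual ℂ T.sun

/-- The canonical injection `j : X → X^{⊙*}`, `⟨j x, φ⟩ = ⟨φ, x⟩`. -/
def j (T : C0Semigroup E) : E →L[ℂ] T.SunStar := T.sun.subtypeL.flip

/-- `X^{⊙⊙}`: the maximal subspace of strong continuity of `T^{⊙*}` on `X^{⊙*}`. -/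
def sunSun (T : C0Semigroup E) : Submodule ℂ T.SunStar := T.sunSemigroup.sun

/-- `X` is sun-reflexive with respect to `T`: `j` maps `X` onto `X^{⊙⊙}`. -/
def IsSunReflexive (T : C0Semigroup E) : Prop :=
  ∀ Φ ∈ T.sunSun, ∃ x : E, T.j x = Φ

/-- `A^{⊙*}`, the weak-star generator of the semigroup `T^{⊙*}` on `X^{⊙*}`. -/
def sunStarGenerator (T : C0Semigroup E) : Submodule ℂ (T.SunStar × T.SunStar) :=
  T.sunSemigroup.weakStarGenerator

/-- `T` is the perturbation of `T₀` by `L : X → X^{⊙*}`: for all `t ≥ 0` and `x`,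
`T(t) x = T₀(t) x + j⁻¹ ∫₀ᵗ T₀^{⊙*}(t - τ) L T(τ) x dτ`, where the weak-star integral is
evaluated against an arbitrary `φ ∈ X^⊙`. -/
def IsPerturbation (T₀ : C0Semigroup E) (L : E →L[ℂ] T₀.SunStar) (T : C0Semigroup E) : Prop :=
  ∀ (t : ℝ≥0) (x : E) (φ : T₀.sun),
    T₀.j (T.toFun t x) φ = T₀.j (T₀.toFun t x) φ +
      ∫ τ in (0 : ℝ)..t, L (T.toFun τ.toNNReal x) (T₀.sunSemigroup.toFun (t - τ.toNNReal) φ)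

/-- The identification `X^{⊙*} → X^{⊙*}` induced by equality of the sun spaces of two semigroups. -/
def sunStarCast {T₀ T : C0Semigroup E} (h : T.sun = T₀.sun) : T₀.SunStar →L[ℂ] T.SunStar :=
  (ContinuousLinearMap.compL ℂ T.sun T₀.sun ℂ).flip
    ((LinearIsometryEquiv.ofEq T.sun T₀.sun h : T.sun →L[ℂ] T₀.sun))

end General

section Augmented

variable {X : Type*} [NormedAddCommGroup X] [NormedSpace ℂ X]

/-- The semigroup `diag (T₀(t), I_p)` on `X × ℂ^p`. -/
def augment (T₀ : C0Semigroup X) (p : ℕ) : C0Semigroup (X × (Fin p → ℂ)) where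
  toFun t := (T₀.toFun t).prodMap (ContinuousLinearMap.id ℂ (Fin p → ℂ))
  toFun_zero := by
    rw [T₀.toFun_zero]
    ext <;> simp
  toFun_add := by
    intro s t
    rw [T₀.toFun_add]
    ext <;> simp
  strongly_continuous := by
    intro x
    exact (T₀.strongly_continuous x.1).prodMk continuous_const

theorem comp_inl_mem_sun (T₀ : C0Semigroup X) (p : ℕ) {φ : StrongDual ℂ (X × (Fin p → ℂ))}
    (hφ : φ ∈ (T₀.augment p).sun) :
    φ.comp (ContinuousLinearMap.inl ℂ X (Fin p → ℂ)) ∈ T₀.sun := by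
  have h : Continuous fun t : ℝ≥0 => φ.comp ((T₀.augment p).toFun t) := hφ
  have h2 : Continuous fun t : ℝ≥0 =>
      (φ.comp ((T₀.augment p).toFun t)).comp (ContinuousLinearMap.inl ℂ X (Fin p → ℂ)) :=
    h.clm_comp continuous_const
  refine h2.congr fun t => ?_
  ext x
  simp [augment]

/-- The first component `(X × ℂ^p)^⊙ → X^⊙` of the identification
`(X × ℂ^p)^⊙ ≃ X^⊙ × ℂ^p`. -/
def sunFst (T₀ : C0Semigroup X) (p : ℕ) : (T₀.augment p).sun →L[ℂ] T₀.sun :=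
  (((ContinuousLinearMap.compL ℂ X (X × (Fin p → ℂ)) ℂ).flip
    (ContinuousLinearMap.inl ℂ X (Fin p → ℂ))).comp (T₀.augment p).sun.subtypeL).codRestrict
      T₀.sun (fun φ => T₀.comp_inl_mem_sun p φ.2)

/-- The embedding `Φ ↦ (Φ, 0)` of `X^{⊙*}` into `(X × ℂ^p)^{⊙*} ≃ X^{⊙*} × ℂ^p`. -/
def sunStarInl (T₀ : C0Semigroup X) (p : ℕ) : T₀.SunStar →L[ℂ] (T₀.augment p).SunStar :=
  (ContinuousLinearMap.compL ℂ (T₀.augment p).sun T₀.sun ℂ).flip (T₀.sunFst p)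

/-- The perturbation `(x, α) ↦ (L x + L_p α, 0)`, with values in `(X × ℂ^p)^{⊙*}`. -/
def augmentPerturbation (T₀ : C0Semigroup X) {p : ℕ} (L : X →L[ℂ] T₀.SunStar)
    (Lp : (Fin p → ℂ) →L[ℂ] T₀.SunStar) :
    (X × (Fin p → ℂ)) →L[ℂ] (T₀.augment p).SunStar :=
  (T₀.sunStarInl p).comp (L.coprod Lp)

end Augmented

end C0Semigroup

section Operators

variable {E : Type*} [NormedAddCommGroup E] [NormedSpace ℂ E]

/-- The null space of `(A - lam)^n` for an unbounded operator with graph `A`. -/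
def kerPow (A : Submodule ℂ (E × E)) (lam : ℂ) : ℕ → Submodule ℂ E
  | 0 => ⊥
  | n + 1 => (A ⊓ (kerPow A lam n).comap
      (LinearMap.snd ℂ E E - lam • LinearMap.fst ℂ E E)).map (LinearMap.fst ℂ E E)

theorem mem_kerPow_succ (A : Submodule ℂ (E × E)) (lam : ℂ) (n : ℕ) (x : E) :
    x ∈ kerPow A lam (n + 1) ↔ ∃ y, (x, y) ∈ A ∧ y - lam • x ∈ kerPow A lam n := by
  simp [kerPow]

/-- The generalized eigenspace `M_lam(A)`, the union of the null spaces of `(A - lam)^n`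
(an increasing sequence); it is trivial iff `lam` is not an eigenvalue. -/
def genEigenspace (A : Submodule ℂ (E × E)) (lam : ℂ) : Submodule ℂ E :=
  ⨆ n, kerPow A lam n

/-- The center eigenspace: the span of the generalized eigenspaces for all eigenvalues on the
imaginary axis (zero included). -/
def centerEigenspace (A : Submodule ℂ (E × E)) : Submodule ℂ E :=
  ⨆ (lam : ℂ) (_ : lam.re = 0), genEigenspace A lam

/-- `R` is the bounded inverse of `z - A`, where `A` is given by its graph. -/
def IsResolventAt (A : Submodule ℂ (E × E)) (z : ℂ) (R : E →L[ℂ] E) : Prop :=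
  (∀ y, (R y, z • R y - y) ∈ A) ∧ ∀ x w, (x, w) ∈ A → R (z • x - w) = x

/-- The resolvent set of an unbounded operator with graph `A`. -/
def unboundedResolventSet (A : Submodule ℂ (E × E)) : Set ℂ :=
  {z | ∃ R : E →L[ℂ] E, IsResolventAt A z R}

open Classical in
/-- The resolvent operator `R_z(A) = (z - A)⁻¹`, used only for `z` in the resolvent set. -/
def unboundedResolvent (A : Submodule ℂ (E × E)) (z : ℂ) : E →L[ℂ] E :=
  if h : z ∈ unboundedResolventSet A then h.choose else 0

/-- `f` is holomorphic in a punctured disc about `a`, with residue `c` at `a`. -/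
def HasResidueAt {F : Type*} [NormedAddCommGroup F] [NormedSpace ℂ F]
    (f : ℂ → F) (a : ℂ) (c : F) : Prop :=
  ∃ ρ > 0, DifferentiableOn ℂ f (Metric.ball a ρ \ {a}) ∧
    ∀ r, 0 < r → r < ρ → (2 * (Real.pi : ℂ) * Complex.I)⁻¹ • (∮ z in C(a, r), f z) = c

end Operators

end

/-! ### Compact perturbations of the identity and the analytic Fredholm theorem -/

section AnalyticFredholm

variable {X : Type*} [NormedAddCommGroup X] [NormedSpace ℂ X]

/-! The generator of `TT` is block triangular with zero bottom row: it sends `(x, α)` to `(y, 0)`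
exactly when `A^{⊙*} j x = j y - L_p α` (`mem_generator_augment_iff`). For `λ ≠ 0` this forces `α =
0` on generalized eigenvectors, so nothing new appears there. At `λ = 0` everything reduces to
completing each `α` to a generalized null vector `(g α, α)`; subtracting such vectors brings any
other one back to `α = 0`.

The completion comes from the Laurent series `R(z) = ∑ R_k z^k` of the resolvent of `A^{⊙*}` at `0`.
Comparing coefficients in `(z - A^{⊙*}) R(z) = I` gives `A^{⊙*} R_0 = R_{-1} - I` and `A^{⊙*} R_{-k}
= R_{-k-1}` for `k ≥ 1`. As the polar part is finite, `R_{-1}` takes values in the kernel of a power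
of the generator. Since `R_0` is the residue of `z⁻¹ R(z)`, that is `Γ₀`, the choice `g = j⁻¹ Γ₀
L_p` works (`exists_laurent_coefficients`, `centerEigenspace_augment_eq`).

It remains to see that `R` is meromorphic with values in `j(X)`. Take `t > 0` with `T₀(t)` compact
and let `S(z)` be `j⁻¹` applied to `∫₀ᵗ e^{-zs} T₀^{⊙*}(s) ds`, which sun-reflexivity allows.
Integrating `A^{⊙*} = A₀^{⊙*} + L j⁻¹` over `[0, t]` turns `(z - A^{⊙*}) j x = Φ` into `(1 - D(z)) x
= S(z) Φ` with `D(z) = e^{-zt} T₀(t) + S(z) L`, an entire family of compact operators that is small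
for large real `z`. Analytic Fredholm theory then gives `R(z) = j (1 - D(z))⁻¹ S(z)`
(`exists_meromorphicAt_isResolventAt`). -/

theorem IsCompactOperator.one_sub_isUnit_of_injective [CompleteSpace X] {C : X →L[ℂ] X}
    (hC : IsCompactOperator C) (h : Function.Injective (1 - C : X →L[ℂ] X)) :
    IsUnit (1 - C : X →L[ℂ] X) := by
  rcases hC.hasEigenvalue_or_mem_resolventSet one_ne_zero with h1 | h1
  · obtain ⟨v, hv⟩ := h1.exists_hasEigenvector
    refine absurd (h (a₁ := v) (a₂ := 0) ?_) hv.2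
    have := hv.apply_eq_smul
    simp only [one_smul] at this
    have h2 : C v = v := this
    simp [h2]
  · simpa [spectrum.mem_resolventSet_iff] using h1

/-- On this kernel `C` is the identity, which is therefore compact there. -/
theorem IsCompactOperator.finiteDimensional_ker_one_sub {C : X →L[ℂ] X}
    (hC : IsCompactOperator C) : FiniteDimensional ℂ (1 - C : X →L[ℂ] X).ker := by
  have hclosed : IsClosed ((1 - C : X →L[ℂ] X).ker : Set X) :=
    ContinuousLinearMap.isClosed_ker _
  have key : ∀ x ∈ (1 - C : X →L[ℂ] X).ker, C x = x := by
    intro x hx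
    have : x - C x = 0 := hx
    exact (sub_eq_zero.1 this).symm
  have hm : ∀ x ∈ (1 - C : X →L[ℂ] X).ker, C.toLinearMap x ∈ (1 - C : X →L[ℂ] X).ker := by
    intro x hx
    have : C.toLinearMap x = x := key x hx
    rwa [this]
  have h := IsCompactOperator.restrict (f := C.toLinearMap) hC hm hclosed
  refine FiniteDimensional.of_isCompactOperator_id (𝕜 := ℂ) ?_
  have hid : (id : (1 - C : X →L[ℂ] X).ker → (1 - C : X →L[ℂ] X).ker) =
      C.toLinearMap.restrict hm := by
    funext x
    exact Subtype.ext (key x.1 x.2).symm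
  rw [hid]
  exact h

/-- Inverting `1 - C` on a closed complement of its kernel gives a right inverse `R`. Then `R = 1 +
C R` is an injective compact perturbation of the identity, hence bijective, and a map with a
bijective right inverse is injective. -/
theorem IsCompactOperator.injective_one_sub_of_surjective [CompleteSpace X] {C : X →L[ℂ] X}
    (hC : IsCompactOperator C) (h : Function.Surjective (1 - C : X →L[ℂ] X)) :
    Function.Injective (1 - C : X →L[ℂ] X) := by
  have := hC.finiteDimensional_ker_one_sub
  obtain ⟨q, hq, hcompl⟩ :=
    (Submodule.ClosedComplemented.of_finiteDimensional
      (1 - C : X →L[ℂ] X).ker).exists_isClosed_isCompl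
  have : CompleteSpace q := hq.completeSpace_coe
  let B : q →L[ℂ] X := (1 - C : X →L[ℂ] X).comp q.subtypeL
  have hBi : B.ker = ⊥ := by
    rw [Submodule.eq_bot_iff]
    intro x hx
    have h1 : (x : X) ∈ (1 - C : X →L[ℂ] X).ker := hx
    have := (Submodule.disjoint_def.1 hcompl.disjoint) x h1 x.2
    exact Subtype.ext this
  have hBs : B.range = ⊤ := by
    rw [Submodule.eq_top_iff']
    intro y
    obtain ⟨x, rfl⟩ := h y
    have hx : x ∈ (1 - C : X →L[ℂ] X).ker ⊔ q := by
      rw [hcompl.sup_eq_top]; trivial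
    obtain ⟨u, hu, v, hv, rfl⟩ := Submodule.mem_sup.1 hx
    refine ⟨⟨v, hv⟩, ?_⟩
    have hu' : (1 - C : X →L[ℂ] X) u = 0 := hu
    change (1 - C : X →L[ℂ] X) v = _
    rw [map_add, hu', zero_add]
  let e := ContinuousLinearEquiv.ofBijective B hBi hBs
  let R : X →L[ℂ] X := q.subtypeL.comp e.symm.toContinuousLinearMap
  have hR : ∀ x, R x - C (R x) = x := fun x => by
    have : B (e.symm x) = x := ContinuousLinearEquiv.ofBijective_apply_symm_apply B hBi hBs x
    simpa [B, R] using this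
  have hCR : IsCompactOperator (-(C.comp R) : X →L[ℂ] X) := (hC.comp_clm R).neg
  have hRe : R = 1 - -(C.comp R) := by
    ext x
    have := hR x
    simp only [sub_neg_eq_add, add_apply,
      one_apply_eq_self, ContinuousLinearMap.comp_apply]
    rw [← sub_eq_iff_eq_add]; exact this
  have hRinj : Function.Injective R := fun x y hxy => by rw [← hR x, ← hR y, hxy]
  have hRu : IsUnit R := by
    rw [hRe]
    exact hCR.one_sub_isUnit_of_injective (by rw [← hRe]; exact hRinj)
  have hRs : Function.Surjective R := ((ContinuousLinearMap.isUnit_iff_bijective).1 hRu).2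
  intro x y hxy
  obtain ⟨x', rfl⟩ := hRs x
  obtain ⟨y', rfl⟩ := hRs y
  have h1 : R x' - C (R x') = R y' - C (R y') := hxy
  rw [hR, hR] at h1
  rw [h1]

/-- A compact perturbation of the identity becomes invertible after adding a suitable operator of
finite rank. -/
theorem IsCompactOperator.exists_isUnit_one_sub_add [CompleteSpace X] {C : X →L[ℂ] X}
    (hC : IsCompactOperator C) : ∃ (n : ℕ) (f : X →L[ℂ] (Fin n → ℂ)) (g : (Fin n → ℂ) →L[ℂ] X),
      IsUnit (1 - C + g.comp f) := by
  induction hd : Module.finrank ℂ (1 - C : X →L[ℂ] X).ker generalizing C with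
  | zero =>
    refine ⟨0, 0, 0, ?_⟩
    have := hC.finiteDimensional_ker_one_sub
    rw [Submodule.finrank_eq_zero] at hd
    simpa using hC.one_sub_isUnit_of_injective (LinearMap.ker_eq_bot.1 hd)
  | succ d ih =>
    have hfd := hC.finiteDimensional_ker_one_sub
    have hne : (1 - C : X →L[ℂ] X).ker ≠ ⊥ := fun h0 => by
      rw [h0, finrank_bot] at hd; omega
    obtain ⟨v, hv, hv0⟩ := Submodule.exists_mem_ne_zero_of_ne_bot hne
    have hns : ¬ Function.Surjective (1 - C : X →L[ℂ] X) := fun hs =>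
      hne (LinearMap.ker_eq_bot.2 (hC.injective_one_sub_of_surjective hs))
    simp only [Function.Surjective, not_forall, not_exists] at hns
    obtain ⟨y, hy⟩ := hns
    obtain ⟨φ, hφ⟩ := SeparatingDual.exists_ne_zero (R := ℂ) hv0
    -- Here `1 - C' = (1 - C) + φ ⊗ y` with `y` outside the range of `1 - C` and `φ v ≠ 0` for a
    -- kernel vector `v`. The new kernel is the part of the old one where `φ` vanishes, so the
    -- dimension drops by exactly one.
    let C' : X →L[ℂ] X := C - φ.smulRight y
    have hC' : IsCompactOperator C' := by
      refine IsCompactOperator.sub hC ?_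
      have h1 : IsCompactOperator φ :=
        ⟨Metric.closedBall 0 1, isCompact_closedBall _ _, φ.continuous.continuousAt.preimage_mem_nhds
          (by simpa using Metric.closedBall_mem_nhds (0 : ℂ) one_pos)⟩
      exact h1.clm_comp ((ContinuousLinearMap.id ℂ ℂ).smulRight y)
    have hker : ∀ x, x ∈ (1 - C' : X →L[ℂ] X).ker → φ x = 0 ∧ x ∈ (1 - C : X →L[ℂ] X).ker := by
      intro x hx
      have h1 : (1 - C : X →L[ℂ] X) x + φ x • y = 0 := by
        have : x - (C x - φ x • y) = 0 := hx
        simpa [sub_add] using this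
      have h2 : φ x = 0 := by
        by_contra h3
        apply hy (-(φ x)⁻¹ • x)
        rw [map_smul, eq_neg_of_add_eq_zero_left h1, smul_neg, neg_smul, neg_neg, smul_smul,
          inv_mul_cancel₀ h3, one_smul]
      refine ⟨h2, ?_⟩
      simpa [h2] using h1
    have hfd' := hC'.finiteDimensional_ker_one_sub
    have hker' : (1 - C' : X →L[ℂ] X).ker ⊔ Submodule.span ℂ {v} = (1 - C : X →L[ℂ] X).ker := by
      apply le_antisymm
      · refine sup_le (fun x hx => (hker x hx).2) ?_
        rw [Submodule.span_singleton_le_iff_mem]; exact hv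
      · intro x hx
        rw [Submodule.mem_sup]
        refine ⟨x - (φ x / φ v) • v, ?_, (φ x / φ v) • v,
          Submodule.smul_mem _ _ (Submodule.mem_span_singleton_self v), by abel⟩
        have h3 : x - (φ x / φ v) • v ∈ (1 - C : X →L[ℂ] X).ker :=
          Submodule.sub_mem _ hx (Submodule.smul_mem _ _ hv)
        have h4 : φ (x - (φ x / φ v) • v) = 0 := by simp [hφ]
        have h5 : (x - (φ x / φ v) • v) - C (x - (φ x / φ v) • v) = 0 := h3
        change (x - (φ x / φ v) • v) - (C (x - (φ x / φ v) • v) -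
          φ (x - (φ x / φ v) • v) • y) = 0
        rw [h4, zero_smul, sub_zero, h5]
    have hdisj : (1 - C' : X →L[ℂ] X).ker ⊓ Submodule.span ℂ {v} = ⊥ := by
      rw [Submodule.eq_bot_iff]
      rintro x ⟨hx1, hx2⟩
      obtain ⟨c, rfl⟩ := Submodule.mem_span_singleton.1 hx2
      have := (hker _ hx1).1
      simp only [map_smul, smul_eq_mul, mul_eq_zero, hφ, or_false] at this
      simp [this]
    have hfr : Module.finrank ℂ (1 - C' : X →L[ℂ] X).ker = d := by
      have := Submodule.finrank_sup_add_finrank_inf_eq (1 - C' : X →L[ℂ] X).ker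
        (Submodule.span ℂ {v})
      rw [hker', hdisj, hd, finrank_bot, finrank_span_singleton hv0] at this
      omega
    obtain ⟨n, f, g, hu⟩ := ih hC' hfr
    let f' : X →L[ℂ] (Fin (n + 1) → ℂ) :=
      ContinuousLinearMap.pi (Fin.cons φ fun i => (ContinuousLinearMap.proj i).comp f)
    let g' : (Fin (n + 1) → ℂ) →L[ℂ] X :=
      (ContinuousLinearMap.proj 0).smulRight y +
        g.comp (ContinuousLinearMap.pi fun i => ContinuousLinearMap.proj i.succ)
    refine ⟨n + 1, f', g', ?_⟩
    convert hu using 1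
    ext x
    have h1 : g' (f' x) = φ x • y + g (f x) := by
      simp only [g', f', add_apply, ContinuousLinearMap.smulRight_apply,
        ContinuousLinearMap.proj_apply, ContinuousLinearMap.coe_pi', Fin.cons_zero,
        ContinuousLinearMap.comp_apply, Fin.cons_succ]
    simp only [add_apply, sub_apply, one_apply_eq_self,
      ContinuousLinearMap.comp_apply, h1, C', ContinuousLinearMap.smulRight_apply]
    abel

theorem ringInverse_eq_of_mul_eq_one {M : Type*} [MonoidWithZero M] {a b : M} (h : a * b = 1)
    (h' : b * a = 1) : Ring.inverse a = b :=
  Ring.inverse_unit ⟨a, b, h, h'⟩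

/-- Cramer's rule: the determinant is analytic, so near `a` it vanishes identically or only possibly
at `a`, and the inverse is adjugate over determinant. Expanding in matrix units leaves scalar
meromorphic coefficients, which survive composition with the fixed operators `ι` and `π` below. -/
theorem meromorphicAt_ringInverse_of_analyticAt {n : ℕ}
    {G : ℂ → (Fin n → ℂ) →L[ℂ] (Fin n → ℂ)} {a : ℂ} (hG : AnalyticAt ℂ G a) :
    (∀ᶠ z in 𝓝[≠] a, ¬ IsUnit (G z)) ∨
      ((∀ᶠ z in 𝓝[≠] a, IsUnit (G z)) ∧ ∃ h : Fin n → Fin n → ℂ → ℂ,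
        (∀ i j, MeromorphicAt (h i j) a) ∧ ∀ᶠ z in 𝓝[≠] a, Ring.inverse (G z) =
          ∑ i, ∑ j, h i j z • (Matrix.toLin' (Matrix.single i j (1 : ℂ))).toContinuousLinearMap) := by
  let A : ℂ → Matrix (Fin n) (Fin n) ℂ := fun z => LinearMap.toMatrix' (G z).toLinearMap
  have hA : ∀ i j, AnalyticAt ℂ (fun z => A z i j) a := by
    intro i j
    let ev : ((Fin n → ℂ) →L[ℂ] (Fin n → ℂ)) →L[ℂ] ℂ :=
      (ContinuousLinearMap.proj (R := ℂ) (φ := fun _ : Fin n => ℂ) i).comp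
        (ContinuousLinearMap.apply ℂ (Fin n → ℂ) (Pi.single j 1 : Fin n → ℂ))
    have h1 : (fun z => A z i j) = fun z => ev (G z) := by
      funext z
      simp [A, ev, LinearMap.toMatrix'_apply]
    rw [h1]
    exact (ev.analyticAt _).comp hG
  have hdet : ∀ M : ℂ → Matrix (Fin n) (Fin n) ℂ, (∀ i j, AnalyticAt ℂ (fun z => M z i j) a) →
      AnalyticAt ℂ (fun z => (M z).det) a := by
    intro M hM
    simp only [Matrix.det_apply']
    exact Finset.analyticAt_fun_sum _ fun σ _ =>
      analyticAt_const.mul (Finset.analyticAt_fun_prod _ fun i _ => hM _ _)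
  have hunit : ∀ z, IsUnit (G z) ↔ (A z).det ≠ 0 := by
    intro z
    rw [ContinuousLinearMap.isUnit_iff_isUnit_toLinearMap, ← isUnit_iff_ne_zero,
      ← Matrix.isUnit_iff_isUnit_det]
    exact (MulEquiv.isUnit_map (LinearMap.toMatrixAlgEquiv' (R := ℂ) (n := Fin n))).symm
  rcases (hdet A hA).eventually_eq_zero_or_eventually_ne_zero with h0 | h0
  · left
    filter_upwards [h0.filter_mono nhdsWithin_le_nhds] with z hz
    rw [hunit, hz]
    simp
  · right
    refine ⟨h0.mono fun z hz => (hunit z).2 hz,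
      fun i j z => ((A z).det)⁻¹ * (A z).adjugate i j, ?_, ?_⟩
    · intro i j
      refine MeromorphicAt.mul (hdet A hA).meromorphicAt.inv (AnalyticAt.meromorphicAt ?_)
      simp only [Matrix.adjugate_apply]
      refine hdet _ fun k l => ?_
      by_cases hk : k = j
      · subst hk
        simpa using analyticAt_const
      · simpa [Matrix.updateRow_ne hk] using hA k l
    · filter_upwards [h0] with z hz
      have hAu : IsUnit (A z).det := isUnit_iff_ne_zero.2 hz
      have h1 : ∑ i, ∑ j, (((A z).det)⁻¹ * (A z).adjugate i j) •
          (Matrix.toLin' (Matrix.single i j (1 : ℂ))).toContinuousLinearMap =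
          (Matrix.toLin' (A z)⁻¹).toContinuousLinearMap := by
        conv_rhs => rw [Matrix.matrix_eq_sum_single (A z)⁻¹]
        simp only [map_sum]
        refine Finset.sum_congr rfl fun i _ => Finset.sum_congr rfl fun j _ => ?_
        rw [← map_smul, ← map_smul, Matrix.smul_single, smul_eq_mul, mul_one, Matrix.inv_def,
          Ring.inverse_eq_inv', Matrix.smul_apply, smul_eq_mul]
      have hGA : ∀ w, G z w = (A z).mulVec w := fun w => by
        simp [A, LinearMap.toMatrix'_mulVec]
      rw [h1]
      refine ringInverse_eq_of_mul_eq_one ?_ ?_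
      · ext1 w
        change G z ((Matrix.toLin' (A z)⁻¹) w) = w
        rw [hGA, Matrix.toLin'_apply, Matrix.mulVec_mulVec, Matrix.mul_nonsing_inv _ hAu,
          Matrix.one_mulVec]
      · ext1 w
        change (Matrix.toLin' (A z)⁻¹) (G z w) = w
        rw [hGA, Matrix.toLin'_apply, Matrix.mulVec_mulVec, Matrix.nonsing_inv_mul _ hAu,
          Matrix.one_mulVec]

/-- A finite-rank correction makes `M = B + ι π` invertible near `a`, with inverse `R`. Since `B = M
(1 - R ι π)`, passing from `1 - R ι π` to `1 - π R ι` reduces invertibility to the matrix family `G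
= 1 - π R ι`, and `B⁻¹ = R + R ι G⁻¹ π R`. -/
theorem analyticFredholm_local [CompleteSpace X] {B : ℂ → X →L[ℂ] X} {a : ℂ}
    (hB : AnalyticAt ℂ B a) (hC : IsCompactOperator (1 - B a : X →L[ℂ] X)) :
    (∀ᶠ z in 𝓝[≠] a, ¬ IsUnit (B z)) ∨
      ((∀ᶠ z in 𝓝[≠] a, IsUnit (B z)) ∧ MeromorphicAt (fun z => Ring.inverse (B z)) a) := by
  obtain ⟨n, π, ι, hu⟩ := hC.exists_isUnit_one_sub_add
  rw [sub_sub_cancel] at hu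
  let M : ℂ → X →L[ℂ] X := fun z => B z + ι.comp π
  have hM : AnalyticAt ℂ M a := hB.add analyticAt_const
  have hMu : ∀ᶠ z in 𝓝[≠] a, IsUnit (M z) :=
    (hM.continuousAt.eventually (Units.isOpen.mem_nhds hu)).filter_mono nhdsWithin_le_nhds
  let R : ℂ → X →L[ℂ] X := fun z => Ring.inverse (M z)
  have hR : AnalyticAt ℂ R a := by
    have := analyticOnNhd_inverse (𝕜 := ℂ) (A := X →L[ℂ] X) (M a) hu
    exact this.comp hM
  let G : ℂ → (Fin n → ℂ) →L[ℂ] (Fin n → ℂ) := fun z => 1 - π.comp ((R z).comp ι)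
  have hG : AnalyticAt ℂ G a := by
    let Λ : (X →L[ℂ] X) →L[ℂ] ((Fin n → ℂ) →L[ℂ] (Fin n → ℂ)) :=
      (ContinuousLinearMap.compL ℂ _ _ _ π).comp ((ContinuousLinearMap.compL ℂ _ _ _).flip ι)
    exact analyticAt_const.sub ((Λ.analyticAt _).comp hR)
  have hBG : ∀ z, IsUnit (M z) → IsUnit (B z) → IsUnit (G z) := by
    intro z h1 h2
    rw [ContinuousLinearMap.isUnit_iff_isUnit_toLinearMap, LinearMap.isUnit_iff_ker_eq_bot,
      LinearMap.ker_eq_bot']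
    intro w hw
    have hw' : w - π (R z (ι w)) = 0 := hw
    have h3 : M z (R z (ι w)) = ι w := by
      have : M z * R z = 1 := Ring.mul_inverse_cancel _ h1
      exact congrArg (fun T : X →L[ℂ] X => T (ι w)) this
    have h4 : B z (R z (ι w)) = 0 := by
      have h5 : B z (R z (ι w)) + ι (π (R z (ι w))) = ι w := h3
      rw [← sub_eq_zero.1 hw'] at h5
      simpa using h5
    have h6 : R z (ι w) = 0 := by
      apply ((ContinuousLinearMap.isUnit_iff_bijective).1 h2).1
      rw [h4, map_zero]
    rw [h6, map_zero, sub_zero] at hw'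
    exact hw'
  have hGB : ∀ z, IsUnit (M z) → IsUnit (G z) → IsUnit (B z) ∧ Ring.inverse (B z) =
      R z + R z * (ι.comp ((Ring.inverse (G z)).comp π)) * R z := by
    intro z h1 h2
    have e1 : M z * R z = 1 := Ring.mul_inverse_cancel _ h1
    have e2 : R z * M z = 1 := Ring.inverse_mul_cancel _ h1
    have e3 : G z * Ring.inverse (G z) = 1 := Ring.mul_inverse_cancel _ h2
    have e4 : Ring.inverse (G z) * G z = 1 := Ring.inverse_mul_cancel _ h2
    set H := Ring.inverse (G z)
    have hBM : B z = M z - ι.comp π := by simp [M]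
    have f1 : ∀ x, B z x = M z x - ι (π x) := fun x => by rw [hBM]; rfl
    have g1 : ∀ x, M z (R z x) = x := fun x => congrArg (fun T : X →L[ℂ] X => T x) e1
    have g2 : ∀ x, R z (M z x) = x := fun x => congrArg (fun T : X →L[ℂ] X => T x) e2
    have g3 : ∀ w, H w - π (R z (ι (H w))) = w := fun w =>
      congrArg (fun T : (Fin n → ℂ) →L[ℂ] (Fin n → ℂ) => T w) e3
    have g4 : ∀ w, H (w - π (R z (ι w))) = w := fun w =>
      congrArg (fun T : (Fin n → ℂ) →L[ℂ] (Fin n → ℂ) => T w) e4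
    have p1 : B z * (R z + R z * (ι.comp (H.comp π)) * R z) = 1 := by
      ext x
      change B z (R z x + R z (ι (H (π (R z x))))) = x
      rw [f1, map_add, map_add, map_add, g1, g1]
      have := congrArg ι (g3 (π (R z x)))
      rw [map_sub] at this
      rw [← this]; abel
    have p2 : (R z + R z * (ι.comp (H.comp π)) * R z) * B z = 1 := by
      ext x
      change R z (B z x) + R z (ι (H (π (R z (B z x))))) = x
      rw [f1, map_sub, g2, map_sub π, g4]
      abel
    exact ⟨⟨⟨B z, _, p1, p2⟩, rfl⟩, ringInverse_eq_of_mul_eq_one p1 p2⟩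
  rcases meromorphicAt_ringInverse_of_analyticAt hG with h | ⟨h, c, hc, hcG⟩
  · left
    filter_upwards [h, hMu] with z h1 h2 h3
    exact h1 (hBG z h2 h3)
  · right
    refine ⟨?_, ?_⟩
    · filter_upwards [h, hMu] with z h1 h2
      exact (hGB z h2 h1).1
    · have hm : MeromorphicAt (fun z => R z + R z * (∑ i, ∑ j, c i j z • (ι.comp
          (((Matrix.toLin' (Matrix.single i j (1 : ℂ))).toContinuousLinearMap).comp π))) * R z)
          a := by
        have h1 : MeromorphicAt (fun z => ∑ i, ∑ j, c i j z • (ι.comp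
          (((Matrix.toLin' (Matrix.single i j (1 : ℂ))).toContinuousLinearMap).comp π))) a :=
          MeromorphicAt.fun_sum fun i _ => MeromorphicAt.fun_sum fun j _ =>
            (hc i j).fun_smul (MeromorphicAt.const _ _)
        have hRm := hR.meromorphicAt
        exact hRm.add ((hRm.smul h1).smul hRm)
      refine hm.congr ?_
      filter_upwards [h, hMu, hcG] with z h1 h2 h3
      rw [(hGB z h2 h1).2, h3]
      congr 3
      ext x
      simp [map_sum]

/-- The **analytic Fredholm theorem** for entire families of compact operators. -/
theorem analyticFredholm [CompleteSpace X] {D : ℂ → X →L[ℂ] X}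
    (hD : Differentiable ℂ D) (hC : ∀ z, IsCompactOperator (D z)) {z₁ : ℂ}
    (hz₁ : IsUnit (1 - D z₁)) (a : ℂ) :
    (∀ᶠ z in 𝓝[≠] a, IsUnit (1 - D z)) ∧ MeromorphicAt (fun z => Ring.inverse (1 - D z)) a := by
  have hloc : ∀ a, (∀ᶠ z in 𝓝[≠] a, ¬ IsUnit (1 - D z)) ∨ ((∀ᶠ z in 𝓝[≠] a, IsUnit (1 - D z)) ∧
      MeromorphicAt (fun z => Ring.inverse (1 - D z)) a) := fun a =>
    analyticFredholm_local (analyticAt_const.sub (hD.analyticAt a)) (by simpa using hC a)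
  have hopen : ∀ p : ℂ → Prop, IsOpen {a | ∀ᶠ z in 𝓝[≠] a, p z} := by
    intro p
    rw [isOpen_iff_mem_nhds]
    intro a ha
    have ha' : ∀ᶠ z in 𝓝[≠] a, p z := ha
    rw [eventually_nhdsWithin_iff] at ha'
    filter_upwards [ha'.eventually_nhds] with b hb
    by_cases hba : b = a
    · subst hba; exact ha
    · have h1 : ∀ᶠ z in 𝓝 b, z ≠ a := isOpen_ne.mem_nhds hba
      exact (hb.and h1 |>.mono fun z hz => hz.1 hz.2).filter_mono nhdsWithin_le_nhds
  -- By the local dichotomy, the complement is the set of points with a punctured neighbourhood free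
  -- of invertibility, which is open too. Connectedness of `ℂ` and the point `z₁` then exclude the
  -- degenerate alternative.
  have hclopen : IsClopen {a | ∀ᶠ z in 𝓝[≠] a, IsUnit (1 - D z)} := by
    refine ⟨⟨?_⟩, hopen _⟩
    convert hopen (fun z => ¬ IsUnit (1 - D z)) using 1
    ext b
    constructor
    · intro hb
      rcases hloc b with h | h
      · exact h
      · exact absurd h.1 hb
    · intro hb hb'
      obtain ⟨z, h1, h2⟩ := ((show ∀ᶠ z in 𝓝[≠] b, _ from hb).and
        (show ∀ᶠ z in 𝓝[≠] b, _ from hb')).exists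
      exact h1 h2
  have huniv := hclopen.eq_univ ⟨z₁, by
    have : ContinuousAt (fun z => 1 - D z) z₁ := (continuous_const.sub hD.continuous).continuousAt
    exact (this.eventually (Units.isOpen.mem_nhds hz₁)).filter_mono nhdsWithin_le_nhds⟩
  have ha : ∀ᶠ z in 𝓝[≠] a, IsUnit (1 - D z) := by
    have : a ∈ {a | ∀ᶠ z in 𝓝[≠] a, IsUnit (1 - D z)} := by rw [huniv]; trivial
    exact this
  refine ⟨ha, ?_⟩
  rcases hloc a with h | h
  · obtain ⟨z, h1, h2⟩ := (h.and ha).exists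
    exact absurd h2 h1
  · exact h.2

end AnalyticFredholm

/-! ### Limits along `ℝ≥0` as right derivatives -/

theorem map_coe_add_nhdsGT_zero (s : ℝ) :
    map (fun h : ℝ≥0 => s + (h : ℝ)) (𝓝[>] 0) = 𝓝[>] s := by
  have hemb : IsEmbedding (fun h : ℝ≥0 => s + (h : ℝ)) :=
    (Homeomorph.addLeft s).isEmbedding.comp .subtypeVal
  have himage : (fun h : ℝ≥0 => s + (h : ℝ)) '' Set.Ioi 0 = Set.Ioi s := by
    ext x
    simp only [Set.mem_image, Set.mem_Ioi]
    constructor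
    · rintro ⟨h, hh, rfl⟩
      have : (0 : ℝ) < h := hh
      linarith
    · intro hx
      have h0 : ((x - s).toNNReal : ℝ) = x - s := Real.coe_toNNReal _ (by linarith)
      exact ⟨(x - s).toNNReal, Real.toNNReal_pos.2 (by linarith), by rw [h0]; ring⟩
  rw [hemb.map_nhdsWithin_eq, himage]
  simp

/-- Makes the difference quotients that define generators available to the fundamental theorem of
calculus for right derivatives. -/
theorem hasDerivWithinAt_Ioi_iff_tendsto_nnreal {F : Type*} [NormedAddCommGroup F]
    [NormedSpace ℂ F] {a : ℝ → F} {s : ℝ} {l : F} :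
    HasDerivWithinAt a l (Set.Ioi s) s ↔
      Tendsto (fun h : ℝ≥0 => ((h : ℝ) : ℂ)⁻¹ • (a (s + h) - a s)) (𝓝[>] 0) (𝓝 l) := by
  rw [hasDerivWithinAt_iff_tendsto_slope' (by simp), ← map_coe_add_nhdsGT_zero, tendsto_map'_iff]
  refine tendsto_congr fun h => ?_
  simp only [slope, Function.comp_apply, vsub_eq_sub, add_sub_cancel_left]
  rw [← Complex.ofReal_inv, Complex.coe_smul]

/-! ### Truncated Laplace transforms, sun spaces and weak-star generators -/

namespace C0Semigroup

section Basics

variable {E : Type*} [NormedAddCommGroup E] [NormedSpace ℂ E]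

theorem toFun_add_apply (U : C0Semigroup E) (s t : ℝ≥0) (x : E) :
    U.toFun (s + t) x = U.toFun s (U.toFun t x) := by
  rw [U.toFun_add]; rfl

theorem toFun_zero_apply (U : C0Semigroup E) (x : E) : U.toFun 0 x = x := by
  rw [U.toFun_zero]; rfl

theorem toFun_comm (U : C0Semigroup E) (s t : ℝ≥0) (x : E) :
    U.toFun s (U.toFun t x) = U.toFun t (U.toFun s x) := by
  rw [← U.toFun_add_apply, add_comm, U.toFun_add_apply]

theorem j_apply (T : C0Semigroup E) (x : E) (φ : T.sun) : T.j x φ = φ.1 x := rfl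

theorem sunSemigroup_apply (T : C0Semigroup E) (t : ℝ≥0) (φ : T.sun) (x : E) :
    (T.sunSemigroup.toFun t φ).1 x = φ.1 (T.toFun t x) := rfl

theorem j_mem_sunStarGenerator_def (T : C0Semigroup E) (x : E) (Ψ : T.SunStar) :
    (T.j x, Ψ) ∈ T.sunStarGenerator ↔ ∀ φ : T.sun, Tendsto
      (fun t : ℝ≥0 => ((t : ℝ) : ℂ)⁻¹ • (φ.1 (T.toFun t x) - φ.1 x)) (𝓝[>] 0) (𝓝 (Ψ φ)) :=
  Iff.rfl

theorem continuous_toNNReal_apply (U : C0Semigroup E) (x : E) :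
    Continuous fun s : ℝ => U.toFun s.toNNReal x :=
  (U.strongly_continuous x).comp continuous_real_toNNReal

theorem exists_norm_le [CompleteSpace E] (U : C0Semigroup E) (b : ℝ≥0) :
    ∃ M : ℝ, 0 ≤ M ∧ ∀ t ≤ b, ‖U.toFun t‖ ≤ M := by
  have hb : ∀ x, ∃ C, ∀ t : Set.Iic b, ‖U.toFun t x‖ ≤ C := by
    intro x
    have hK : IsCompact (Set.Icc 0 b) := isCompact_Icc
    obtain ⟨C, hC⟩ := hK.exists_bound_of_continuousOn (U.strongly_continuous x).continuousOn
    exact ⟨C, fun t => hC t ⟨zero_le, t.2⟩⟩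
  obtain ⟨M, hM⟩ := banach_steinhaus hb
  exact ⟨M, (norm_nonneg _).trans (hM ⟨0, Set.mem_Iic.2 zero_le⟩), fun t ht => hM ⟨t, ht⟩⟩

theorem continuous_exp_smul (U : C0Semigroup E) (z : ℂ) (x : E) :
    Continuous fun s : ℝ => Complex.exp (-(z * s)) • U.toFun s.toNNReal x := by
  have := U.continuous_toNNReal_apply x
  fun_prop

/-- The truncated Laplace transform `x ↦ ∫₀ᵗ e^{-zs} U(s) x ds` of a semigroup. -/
noncomputable def truncatedLaplace [CompleteSpace E] (U : C0Semigroup E) (z : ℂ) (t : ℝ≥0) : E →L[ℂ] E :=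
  LinearMap.mkContinuousOfExistsBound
    { toFun := fun x => ∫ s in (0 : ℝ)..t, Complex.exp (-(z * s)) • U.toFun s.toNNReal x
      map_add' := fun x y => by
        simp only [map_add, smul_add]
        exact intervalIntegral.integral_add ((U.continuous_exp_smul z x).intervalIntegrable _ _)
          ((U.continuous_exp_smul z y).intervalIntegrable _ _)
      map_smul' := fun c x => by
        simp only [map_smul, RingHom.id_apply]
        rw [← intervalIntegral.integral_smul]
        congr 1
        funext s
        rw [smul_comm] }
    (by
      obtain ⟨M, hM0, hM⟩ := U.exists_norm_le t
      have hc : Continuous fun s : ℝ => Complex.exp (-(z * s)) := by fun_prop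
      obtain ⟨N, hN⟩ := (isCompact_Icc (a := (0 : ℝ)) (b := t)).exists_bound_of_continuousOn
        hc.continuousOn
      refine ⟨N * M * |(t : ℝ) - 0|, fun x => ?_⟩
      have h := intervalIntegral.norm_integral_le_of_norm_le_const (a := (0 : ℝ)) (b := t)
        (f := fun s : ℝ => Complex.exp (-(z * s)) • U.toFun s.toNNReal x) (C := N * (M * ‖x‖)) ?_
      · refine h.trans (le_of_eq ?_)
        ring
      · intro s hs
        rw [Set.uIoc_of_le t.coe_nonneg] at hs
        rw [norm_smul]
        have h1 : ‖Complex.exp (-(z * s))‖ ≤ N := hN s ⟨hs.1.le, hs.2⟩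
        refine mul_le_mul h1 ?_ (norm_nonneg _) ((norm_nonneg _).trans h1)
        exact (U.toFun s.toNNReal).le_of_opNorm_le (hM _ (Real.toNNReal_le_iff_le_coe.2 hs.2)) x)

variable [CompleteSpace E]

theorem truncatedLaplace_apply (U : C0Semigroup E) (z : ℂ) (t : ℝ≥0) (x : E) :
    U.truncatedLaplace z t x =
      ∫ s in (0 : ℝ)..t, Complex.exp (-(z * s)) • U.toFun s.toNNReal x := rfl

theorem apply_truncatedLaplace {F : Type*} [NormedAddCommGroup F] [NormedSpace ℂ F]
    [CompleteSpace F] (U : C0Semigroup E) (f : E →L[ℂ] F) (z : ℂ) (t : ℝ≥0) (x : E) :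
    f (U.truncatedLaplace z t x) =
      ∫ s in (0 : ℝ)..t, Complex.exp (-(z * s)) • f (U.toFun s.toNNReal x) := by
  rw [truncatedLaplace_apply, ← f.intervalIntegral_comp_comm
    ((U.continuous_exp_smul z x).intervalIntegrable _ _)]
  simp only [map_smul]

theorem truncatedLaplace_toFun_comm (U : C0Semigroup E) (z : ℂ) (t h : ℝ≥0) (x : E) :
    U.truncatedLaplace z t (U.toFun h x) = U.toFun h (U.truncatedLaplace z t x) := by
  rw [apply_truncatedLaplace, truncatedLaplace_apply]
  congr 1
  funext s
  rw [U.toFun_comm]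

theorem truncatedLaplace_add (U : C0Semigroup E) (z : ℂ) (h t : ℝ≥0) (x : E) :
    U.truncatedLaplace z (h + t) x = U.truncatedLaplace z h x +
      Complex.exp (-(z * (h : ℝ))) • U.toFun h (U.truncatedLaplace z t x) := by
  have hint : ∀ a b : ℝ, IntervalIntegrable
      (fun s : ℝ => Complex.exp (-(z * s)) • U.toFun s.toNNReal x) MeasureTheory.volume a b :=
    fun a b => (U.continuous_exp_smul z x).intervalIntegrable _ _
  rw [truncatedLaplace_apply, truncatedLaplace_apply,
    ← intervalIntegral.integral_add_adjacent_intervals (hint 0 h) (hint h _)]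
  congr 1
  rw [apply_truncatedLaplace, ← intervalIntegral.integral_smul]
  have hshift := intervalIntegral.integral_comp_add_right (a := 0) (b := (t : ℝ))
    (fun s : ℝ => Complex.exp (-(z * s)) • U.toFun s.toNNReal x) (h : ℝ)
  rw [zero_add, add_comm (t : ℝ)] at hshift
  rw [NNReal.coe_add, ← hshift]
  refine intervalIntegral.integral_congr fun s hs => ?_
  rw [Set.uIcc_of_le t.coe_nonneg] at hs
  rw [Real.toNNReal_add hs.1 h.coe_nonneg, Real.toNNReal_coe, add_comm s.toNNReal, U.toFun_add_apply,
    smul_smul, ← Complex.exp_add]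
  congr 2
  push_cast
  ring

/-- Integration upgrades strong continuity to operator-norm continuity: the primitive of the
semigroup is locally Lipschitz in norm. This is the source of the elements of the sun space below.
-/
theorem norm_truncatedLaplace_zero_sub_le (U : C0Semigroup E) {b : ℝ≥0} {M : ℝ}
    (hM : ∀ t ≤ b, ‖U.toFun t‖ ≤ M) {s t : ℝ≥0} (hs : s ≤ b) (ht : t ≤ b) :
    ‖U.truncatedLaplace 0 t - U.truncatedLaplace 0 s‖ ≤ M * |(t : ℝ) - s| := by
  have hM0 : 0 ≤ M := (norm_nonneg _).trans (hM 0 zero_le)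
  refine ContinuousLinearMap.opNorm_le_bound _ (by positivity) fun x => ?_
  have hint : ∀ a b : ℝ, IntervalIntegrable
      (fun s : ℝ => Complex.exp (-(0 * s)) • U.toFun s.toNNReal x) MeasureTheory.volume a b :=
    fun a b => (U.continuous_exp_smul 0 x).intervalIntegrable _ _
  rw [sub_apply, truncatedLaplace_apply, truncatedLaplace_apply,
    intervalIntegral.integral_interval_sub_left (hint _ _) (hint _ _)]
  have h := intervalIntegral.norm_integral_le_of_norm_le_const (a := (s : ℝ)) (b := t)
    (f := fun s : ℝ => Complex.exp (-(0 * s)) • U.toFun s.toNNReal x) (C := M * ‖x‖) ?_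
  · refine h.trans (le_of_eq ?_)
    ring
  · intro r hr
    rw [Set.mem_uIoc] at hr
    have hrb : r ≤ b := by
      have h1 : (s : ℝ) ≤ b := hs
      have h2 : (t : ℝ) ≤ b := ht
      rcases hr with hr | hr <;> linarith [hr.2]
    simp only [zero_mul, neg_zero, Complex.exp_zero, one_smul]
    exact (U.toFun r.toNNReal).le_of_opNorm_le (hM _ (Real.toNNReal_le_iff_le_coe.2 hrb)) x

theorem truncatedLaplace_zero_right (U : C0Semigroup E) (z : ℂ) : U.truncatedLaplace z 0 = 0 := by
  ext x
  simp [truncatedLaplace_apply]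

theorem norm_truncatedLaplace_zero_le (U : C0Semigroup E) {b : ℝ≥0} {M : ℝ}
    (hM : ∀ t ≤ b, ‖U.toFun t‖ ≤ M) {t : ℝ≥0} (ht : t ≤ b) :
    ‖U.truncatedLaplace 0 t‖ ≤ M * t := by
  have := U.norm_truncatedLaplace_zero_sub_le hM (zero_le) ht
  simpa [truncatedLaplace_zero_right, abs_of_nonneg t.coe_nonneg] using this

theorem continuous_truncatedLaplace_zero (U : C0Semigroup E) :
    Continuous fun t => U.truncatedLaplace 0 t := by
  rw [continuous_iff_continuousAt]
  intro t
  obtain ⟨M, hM0, hM⟩ := U.exists_norm_le (t + 1)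
  have hev : ∀ᶠ s in 𝓝 t, s ≤ t + 1 := by
    filter_upwards [Iio_mem_nhds (lt_add_one t)] with s hs using le_of_lt hs
  rw [ContinuousAt, tendsto_iff_norm_sub_tendsto_zero]
  refine squeeze_zero' (Eventually.of_forall fun s => norm_nonneg _)
    (hev.mono fun s hs => U.norm_truncatedLaplace_zero_sub_le hM (by simp) hs) ?_
  have : Continuous fun s : ℝ≥0 => M * |(s : ℝ) - t| := by fun_prop
  simpa using this.tendsto t

theorem tendsto_inv_smul_truncatedLaplace (U : C0Semigroup E) (z : ℂ) (x : E) :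
    Tendsto (fun t : ℝ≥0 => ((t : ℝ) : ℂ)⁻¹ • U.truncatedLaplace z t x) (𝓝[>] 0) (𝓝 x) := by
  have hc := U.continuous_exp_smul z x
  have h := (intervalIntegral.integral_hasDerivAt_right (hc.intervalIntegrable 0 0)
    hc.aestronglyMeasurable.stronglyMeasurableAtFilter hc.continuousAt).hasDerivWithinAt
      (s := Set.Ioi 0)
  rw [hasDerivWithinAt_Ioi_iff_tendsto_nnreal] at h
  simpa [truncatedLaplace_apply, U.toFun_zero_apply] using h

/-- Norm continuity at `0` propagates, because `φ U(b) - φ U(a) = (φ U(b - a) - φ) U(a)` and `U` is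
locally bounded. -/
theorem mem_sun_iff_tendsto (U : C0Semigroup E) (φ : StrongDual ℂ E) :
    φ ∈ U.sun ↔ Tendsto (fun t : ℝ≥0 => φ.comp (U.toFun t)) (𝓝 0) (𝓝 φ) := by
  constructor
  · intro h
    have h1 : Continuous fun t : ℝ≥0 => φ.comp (U.toFun t) := h
    have := h1.tendsto 0
    rwa [U.toFun_zero, ContinuousLinearMap.comp_id] at this
  · intro h
    change Continuous fun t : ℝ≥0 => φ.comp (U.toFun t)
    rw [continuous_iff_continuousAt]
    intro t
    obtain ⟨M, hM0, hM⟩ := U.exists_norm_le (t + 1)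
    have hle : ∀ a b : ℝ≥0, a ≤ b → a ≤ t + 1 → ‖φ.comp (U.toFun b) - φ.comp (U.toFun a)‖ ≤
        ‖φ.comp (U.toFun (b - a)) - φ‖ * M := by
      intro a b hab ha
      have h1 : φ.comp (U.toFun b) - φ.comp (U.toFun a) =
          (φ.comp (U.toFun (b - a)) - φ).comp (U.toFun a) := by
        conv_lhs => rw [← tsub_add_cancel_of_le hab, U.toFun_add]
        rfl
      rw [h1]
      exact (ContinuousLinearMap.opNorm_comp_le _ _).trans
        (mul_le_mul_of_nonneg_left (hM a ha) (norm_nonneg _))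
    have hev : ∀ᶠ s in 𝓝 t, s ≤ t + 1 := by
      filter_upwards [Iio_mem_nhds (lt_add_one t)] with s hs using le_of_lt hs
    rw [ContinuousAt, tendsto_iff_norm_sub_tendsto_zero]
    refine squeeze_zero' (Eventually.of_forall fun s => norm_nonneg _)
      -- Subtraction in `ℝ≥0` is truncated, so one summand vanishes and the sum is `|s - t|`.
      (g := fun s => ‖φ.comp (U.toFun ((s - t) + (t - s))) - φ‖ * M)
      (hev.mono fun s hs => ?_) ?_
    · rcases le_total s t with hst | hst
      · rw [norm_sub_rev, tsub_eq_zero_of_le hst, zero_add]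
        exact hle s t hst hs
      · rw [tsub_eq_zero_of_le hst, add_zero]
        exact hle t s hst (by simp)
    · have h2 : Tendsto (fun s : ℝ≥0 => (s - t) + (t - s)) (𝓝 t) (𝓝 0) := by
        have : Continuous fun s : ℝ≥0 => (s - t) + (t - s) := by fun_prop
        simpa using this.tendsto t
      have h3 := (tendsto_iff_norm_sub_tendsto_zero.1 (h.comp h2)).mul_const M
      simpa using h3

/-- An `ε/2` argument with the local bound `M`. Closedness makes the sun space complete, so all
results on semigroups here also apply to `T^⊙`. -/
theorem isClosed_sun (U : C0Semigroup E) : IsClosed (U.sun : Set (StrongDual ℂ E)) := by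
  obtain ⟨M, hM0, hM⟩ := U.exists_norm_le 1
  refine isClosed_of_closure_subset fun φ hφ => ?_
  rw [SetLike.mem_coe, mem_sun_iff_tendsto, Metric.tendsto_nhds]
  intro ε hε
  obtain ⟨ψ, hψ, hd⟩ := Metric.mem_closure_iff.1 hφ (ε / (2 * (M + 1))) (by positivity)
  rw [SetLike.mem_coe, mem_sun_iff_tendsto, Metric.tendsto_nhds] at hψ
  have hev : ∀ᶠ s in 𝓝 (0 : ℝ≥0), s ≤ 1 := by
    filter_upwards [Iio_mem_nhds (zero_lt_one (α := ℝ≥0))] with s hs using le_of_lt hs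
  filter_upwards [hψ (ε / 2) (by positivity), hev] with t ht ht1
  rw [dist_eq_norm] at ht hd ⊢
  have h1 : φ.comp (U.toFun t) - φ =
      (φ - ψ).comp (U.toFun t) + (ψ.comp (U.toFun t) - ψ) - (φ - ψ) := by
    rw [ContinuousLinearMap.sub_comp]; abel
  have h2 : ‖(φ - ψ).comp (U.toFun t)‖ ≤ ‖φ - ψ‖ * M :=
    (ContinuousLinearMap.opNorm_comp_le _ _).trans
      (mul_le_mul_of_nonneg_left (hM t ht1) (norm_nonneg _))
  have h3 : ‖φ - ψ‖ * (M + 1) < ε / 2 := by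
    rw [lt_div_iff₀ (by positivity)] at hd
    linarith
  rw [h1]
  refine (norm_sub_le _ _).trans_lt ?_
  have := norm_add_le ((φ - ψ).comp (U.toFun t)) (ψ.comp (U.toFun t) - ψ)
  linarith

instance (U : C0Semigroup E) : CompleteSpace U.sun := U.isClosed_sun.completeSpace_coe

/-- Writing `V` for the primitive, `V(r) U(t) = V(t + r) - V(t)` is norm continuous in `t`. So
smoothing any functional by `V(r)` puts it into the sun space. -/
theorem comp_truncatedLaplace_mem_sun (U : C0Semigroup E) (φ : StrongDual ℂ E) (r : ℝ≥0) :
    φ.comp (U.truncatedLaplace 0 r) ∈ U.sun := by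
  change Continuous fun t : ℝ≥0 => (φ.comp (U.truncatedLaplace 0 r)).comp (U.toFun t)
  have h : ∀ t : ℝ≥0, (φ.comp (U.truncatedLaplace 0 r)).comp (U.toFun t) =
      φ.comp (U.truncatedLaplace 0 (t + r) - U.truncatedLaplace 0 t) := by
    intro t
    ext x
    have := U.truncatedLaplace_add 0 t r x
    simp only [zero_mul, neg_zero, Complex.exp_zero, one_smul] at this
    simp only [ContinuousLinearMap.comp_apply, sub_apply]
    rw [this, truncatedLaplace_toFun_comm]
    simp
  simp_rw [h]
  have hV := U.continuous_truncatedLaplace_zero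
  exact continuous_const.clm_comp ((hV.comp (continuous_id.add continuous_const)).sub hV)

/-- The weak-star generator is characterized by the integrated equation, rescaled by `e^{-zt}`. -/
theorem mem_weakStarGenerator_iff (U : C0Semigroup E) (z : ℂ) (Φ Ψ : StrongDual ℂ E) :
    (Φ, Ψ) ∈ U.weakStarGenerator ↔ ∀ (t : ℝ≥0) (x : E),
      Complex.exp (-(z * (t : ℝ))) • Φ (U.toFun t x) - Φ x =
        (Ψ - z • Φ) (U.truncatedLaplace z t x) := by
  constructor
  · intro h t x
    have h' : ∀ x : E, Tendsto
      (fun t : ℝ≥0 => ((t : ℝ) : ℂ)⁻¹ • (Φ (U.toFun t x) - Φ x)) (𝓝[>] 0) (𝓝 (Ψ x)) := h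
    have ha : ∀ s : ℝ, 0 ≤ s → HasDerivWithinAt (fun s : ℝ => Φ (U.toFun s.toNNReal x))
        (Ψ (U.toFun s.toNNReal x)) (Set.Ioi s) s := by
      intro s hs
      rw [hasDerivWithinAt_Ioi_iff_tendsto_nnreal]
      refine (h' (U.toFun s.toNNReal x)).congr fun t => ?_
      rw [Real.toNNReal_add hs t.coe_nonneg, Real.toNNReal_coe, add_comm, U.toFun_add_apply]
    have he : ∀ s : ℝ, HasDerivAt (fun s : ℝ => Complex.exp (-(z * s)))
        (-z * Complex.exp (-(z * s))) s := by
      intro s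
      have h1 : HasDerivAt (fun s : ℝ => -(z * (s : ℂ))) (-(z * 1)) s :=
        (((hasDerivAt_id (s : ℂ)).comp_ofReal).const_mul z).neg
      have := h1.cexp
      rwa [mul_one, mul_comm] at this
    rw [apply_truncatedLaplace]
    -- Only right derivatives are known, which suffices because the orbit is continuous and the
    -- derivative is integrable.
    have hf := intervalIntegral.integral_eq_sub_of_hasDeriv_right (a := 0) (b := (t : ℝ))
      (f := fun s : ℝ => Complex.exp (-(z * s)) • Φ (U.toFun s.toNNReal x))
      (f' := fun s : ℝ => Complex.exp (-(z * s)) • (Ψ - z • Φ) (U.toFun s.toNNReal x)) ?_ ?_ ?_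
    · rw [hf]
      simp [U.toFun_zero_apply]
    · have := U.continuous_toNNReal_apply x
      exact Continuous.continuousOn (by fun_prop)
    · intro s hs
      rw [min_eq_left t.coe_nonneg] at hs
      have := (he s).hasDerivWithinAt (s := Set.Ioi s) |>.mul (ha s hs.1.le)
      refine this.congr_deriv ?_
      simp only [sub_apply, smul_apply, smul_eq_mul]
      ring
    · have := U.continuous_toNNReal_apply x
      exact Continuous.intervalIntegrable (by fun_prop) _ _
  · intro h x
    -- Conversely, solve the integrated equation for `Φ(U(t) x)` and take the right derivative at
    -- `0` by the product rule; the terms `z Φ x` cancel.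
    have hform : ∀ t : ℝ≥0, ((t : ℝ) : ℂ)⁻¹ • (Φ (U.toFun t x) - Φ x) =
        ((t : ℝ) : ℂ)⁻¹ • (Complex.exp (z * (t : ℝ)) - Complex.exp (z * (0 : ℝ))) * Φ x +
        Complex.exp (z * (t : ℝ)) *
          (Ψ - z • Φ) (((t : ℝ) : ℂ)⁻¹ • U.truncatedLaplace z t x) := by
      intro t
      have h1 := h t x
      have h2 : Φ (U.toFun t x) = Complex.exp (z * (t : ℝ)) * (Φ x +
          (Ψ - z • Φ) (U.truncatedLaplace z t x)) := by
        rw [← h1, add_sub_cancel, smul_eq_mul, ← mul_assoc, ← Complex.exp_add, add_neg_cancel,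
          Complex.exp_zero, one_mul]
      rw [h2, map_smul]
      simp only [smul_eq_mul, Complex.ofReal_zero, mul_zero, Complex.exp_zero]
      ring
    dsimp only
    simp_rw [hform]
    have he : HasDerivAt (fun s : ℝ => Complex.exp (z * s)) z 0 := by
      have h1 : HasDerivAt (fun s : ℝ => z * (s : ℂ)) (z * 1) 0 :=
        ((hasDerivAt_id ((0 : ℝ) : ℂ)).comp_ofReal).const_mul z
      simpa using h1.cexp
    have he1 := he.hasDerivWithinAt (s := Set.Ioi 0)
    rw [hasDerivWithinAt_Ioi_iff_tendsto_nnreal] at he1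
    simp only [zero_add] at he1
    have he2 : Tendsto (fun t : ℝ≥0 => Complex.exp (z * (t : ℝ))) (𝓝[>] 0) (𝓝 1) := by
      have : Continuous fun t : ℝ≥0 => Complex.exp (z * (t : ℝ)) := by fun_prop
      have := this.tendsto 0
      simp only [NNReal.coe_zero, Complex.ofReal_zero, mul_zero, Complex.exp_zero] at this
      exact this.mono_left nhdsWithin_le_nhds
    have hV := ((Ψ - z • Φ).continuous.tendsto _).comp (U.tendsto_inv_smul_truncatedLaplace z x)
    have := (he1.mul_const (Φ x)).add (he2.mul hV)
    have hval : z * Φ x + 1 * (Ψ - z • Φ) x = Ψ x := by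
      simp only [sub_apply, smul_apply, smul_eq_mul]
      ring
    rw [hval] at this
    exact this

theorem mem_weakStarGenerator_iff_zero (U : C0Semigroup E) (Φ Ψ : StrongDual ℂ E) :
    (Φ, Ψ) ∈ U.weakStarGenerator ↔ ∀ (t : ℝ≥0) (x : E),
      Φ (U.toFun t x) - Φ x = Ψ (U.truncatedLaplace 0 t x) := by
  simpa using U.mem_weakStarGenerator_iff 0 Φ Ψ

/-- Each integrated equation is a closed condition on the pair, unlike the limit in the definition.
-/
theorem isClosed_weakStarGenerator (U : C0Semigroup E) :
    IsClosed (U.weakStarGenerator : Set (StrongDual ℂ E × StrongDual ℂ E)) := by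
  have : (U.weakStarGenerator : Set (StrongDual ℂ E × StrongDual ℂ E)) =
      ⋂ (t : ℝ≥0) (x : E), {q | q.1 (U.toFun t x) - q.1 x = q.2 (U.truncatedLaplace 0 t x)} := by
    ext ⟨Φ, Ψ⟩
    simp [mem_weakStarGenerator_iff_zero]
  rw [this]
  refine isClosed_iInter fun t => isClosed_iInter fun x => isClosed_eq ?_ ?_
  all_goals fun_prop

/-- The integrated equation reads `Φ U(t) = Φ + Ψ V(t)`, and the primitive `V` is norm continuous.
-/
theorem weakStarGenerator_fst_mem_sun (U : C0Semigroup E) {Φ Ψ : StrongDual ℂ E}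
    (h : (Φ, Ψ) ∈ U.weakStarGenerator) : Φ ∈ U.sun := by
  rw [mem_weakStarGenerator_iff_zero] at h
  rw [mem_sun_iff_tendsto]
  have h1 : ∀ t : ℝ≥0, Φ.comp (U.toFun t) = Φ + Ψ.comp (U.truncatedLaplace 0 t) := by
    intro t
    ext x
    have := h t x
    simp only [ContinuousLinearMap.comp_apply, add_apply]
    rw [← this]; ring
  simp_rw [h1]
  have hc : Continuous fun t => Φ + Ψ.comp (U.truncatedLaplace 0 t) :=
    continuous_const.add (continuous_const.clm_comp U.continuous_truncatedLaplace_zero)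
  simpa [truncatedLaplace_zero_right] using hc.tendsto 0

/-- Test `x` against `r⁻¹ φ V(r)`, where `φ` is norming for `x`: these functionals lie in the sun
space, have norm at most `M`, and their values tend to `φ x = ‖x‖` as `r ↓ 0`. -/
theorem exists_norm_le_norm_j (T : C0Semigroup E) : ∃ c : ℝ, 0 ≤ c ∧ ∀ x, ‖x‖ ≤ c * ‖T.j x‖ := by
  obtain ⟨M, hM0, hM⟩ := T.exists_norm_le 1
  refine ⟨M, hM0, fun x => ?_⟩
  obtain ⟨φ, hφ1, hφ⟩ := exists_dual_vector'' ℂ x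
  have hlim := ((φ.continuous.tendsto _).comp (T.tendsto_inv_smul_truncatedLaplace 0 x)).norm
  rw [hφ] at hlim
  simp only [RCLike.norm_ofReal, abs_norm] at hlim
  refine le_of_tendsto hlim ?_
  have hev : ∀ᶠ s in 𝓝[>] (0 : ℝ≥0), s ≤ 1 := by
    filter_upwards [nhdsWithin_le_nhds (Iio_mem_nhds (zero_lt_one (α := ℝ≥0)))] with s hs
      using le_of_lt hs
  filter_upwards [hev, self_mem_nhdsWithin] with r hr hr0
  have hr0' : (0 : ℝ) < r := hr0
  let ψ : T.sun := ⟨φ.comp (T.truncatedLaplace 0 r), T.comp_truncatedLaplace_mem_sun φ r⟩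
  have h1 : ‖ψ‖ ≤ M * r := by
    refine (ContinuousLinearMap.opNorm_comp_le _ _).trans ?_
    have := T.norm_truncatedLaplace_zero_le hM hr
    calc ‖φ‖ * ‖T.truncatedLaplace 0 r‖ ≤ 1 * (M * r) :=
          mul_le_mul hφ1 this (norm_nonneg _) zero_le_one
      _ = M * r := one_mul _
  have h2 : ‖φ (T.truncatedLaplace 0 r x)‖ ≤ ‖T.j x‖ * (M * r) :=
    ((T.j x).le_opNorm ψ).trans (mul_le_mul_of_nonneg_left h1 (norm_nonneg _))
  rw [Function.comp_apply, map_smul, norm_smul, norm_inv, Complex.norm_real, Real.norm_of_nonneg r.coe_nonneg,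
    inv_mul_le_iff₀ hr0']
  linarith

theorem j_injective (T : C0Semigroup E) : Function.Injective T.j := by
  obtain ⟨c, hc0, hc⟩ := T.exists_norm_le_norm_j
  rw [injective_iff_map_eq_zero]
  intro x hx
  have := hc x
  rw [hx, norm_zero, mul_zero] at this
  exact norm_le_zero_iff.1 this

theorem j_truncatedLaplace (T : C0Semigroup E) (z : ℂ) (t : ℝ≥0) (x : E) (φ : T.sun) :
    T.j x (T.sunSemigroup.truncatedLaplace z t φ) = φ.1 (T.truncatedLaplace z t x) := by
  rw [apply_truncatedLaplace, apply_truncatedLaplace]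
  rfl

/-- The nontrivial direction passes from weak-star to norm convergence: since `j` is injective, the
integrated equation descends to `T(t) x - x = ∫₀ᵗ T(s) y ds` in the space itself. -/
theorem mem_generator_iff_j (T : C0Semigroup E) (x y : E) :
    (x, y) ∈ T.generator ↔ (T.j x, T.j y) ∈ T.sunStarGenerator := by
  constructor
  · intro h φ
    have h' : Tendsto (fun t : ℝ≥0 => ((t : ℝ) : ℂ)⁻¹ • (T.toFun t x - x)) (𝓝[>] 0) (𝓝 y) := h
    have := (φ.1.continuous.tendsto _).comp h'
    refine this.congr fun t => ?_
    rw [Function.comp_apply, map_smul, map_sub]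
    rfl
  · intro h
    have h1 : ∀ t : ℝ≥0, T.toFun t x - x = T.truncatedLaplace 0 t y := by
      intro t
      apply T.j_injective
      ext φ
      have := (mem_weakStarGenerator_iff_zero _ _ _).1 h t φ
      rw [j_truncatedLaplace] at this
      rw [map_sub]
      exact this
    change Tendsto (fun t : ℝ≥0 => ((t : ℝ) : ℂ)⁻¹ • (T.toFun t x - x)) (𝓝[>] 0) (𝓝 y)
    simp_rw [h1]
    exact T.tendsto_inv_smul_truncatedLaplace 0 y

end Basics

end C0Semigroup

/-! ### Perturbed semigroups and their generators -/

namespace C0Semigroup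

section SunStarCast

variable {E : Type*} [NormedAddCommGroup E] [NormedSpace ℂ E] {T₀ T : C0Semigroup E}

theorem sunStarCast_j (h : T.sun = T₀.sun) (x : E) : sunStarCast h (T₀.j x) = T.j x := rfl

theorem sunStarCast_sunStarCast_symm (h : T.sun = T₀.sun) (Φ : T.SunStar) :
    sunStarCast h (sunStarCast h.symm Φ) = Φ := rfl

end SunStarCast

section NormedSpace

variable {X : Type*} [NormedAddCommGroup X] [NormedSpace ℂ X]

/-- The integrand is jointly continuous in its two times `τ` and `t - τ`, both at most `t`, so its
average tends to the value at `(0, 0)`. -/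
theorem tendsto_inv_smul_duhamel (T₀ T : C0Semigroup X) (L : X →L[ℂ] T₀.SunStar)
    (x : X) (φ : T₀.sun) :
    Tendsto (fun t : ℝ≥0 => ((t : ℝ) : ℂ)⁻¹ • ∫ τ in (0 : ℝ)..t,
      L (T.toFun τ.toNNReal x) (T₀.sunSemigroup.toFun (t - τ.toNNReal) φ)) (𝓝[>] 0)
      (𝓝 (L x φ)) := by
  have hF : Continuous fun q : ℝ≥0 × ℝ≥0 => L (T.toFun q.1 x) (T₀.sunSemigroup.toFun q.2 φ) :=
    (L.continuous.comp ((T.strongly_continuous x).comp continuous_fst)).clm_apply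
      ((T₀.sunSemigroup.strongly_continuous φ).comp continuous_snd)
  rw [Metric.tendsto_nhds]
  intro ε hε
  have h0 := Metric.tendsto_nhds.1 (hF.tendsto (0, 0)) (ε / 2) (half_pos hε)
  rw [toFun_zero_apply, toFun_zero_apply, nhds_prod_eq, eventually_prod_iff] at h0
  obtain ⟨p, hp, q, hq, hpq⟩ := h0
  obtain ⟨δ, hδ, hδ'⟩ := Metric.eventually_nhds_iff.1 (hp.and hq)
  have hev : ∀ᶠ t : ℝ≥0 in 𝓝[>] 0, dist t 0 < δ :=
    nhdsWithin_le_nhds (Metric.ball_mem_nhds 0 hδ)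
  filter_upwards [hev, self_mem_nhdsWithin] with t ht ht0
  have ht0' : (0 : ℝ) < t := ht0
  have htne : ((t : ℝ) : ℂ) ≠ 0 := by exact_mod_cast ht0'.ne'
  have hc : Continuous fun τ : ℝ =>
      L (T.toFun τ.toNNReal x) (T₀.sunSemigroup.toFun (t - τ.toNNReal) φ) :=
    hF.comp (continuous_real_toNNReal.prodMk (continuous_const.sub continuous_real_toNNReal))
  have hsub : ((t : ℝ) : ℂ)⁻¹ • (∫ τ in (0 : ℝ)..t,
      L (T.toFun τ.toNNReal x) (T₀.sunSemigroup.toFun (t - τ.toNNReal) φ)) - L x φ =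
      ((t : ℝ) : ℂ)⁻¹ • ∫ τ in (0 : ℝ)..t,
        (L (T.toFun τ.toNNReal x) (T₀.sunSemigroup.toFun (t - τ.toNNReal) φ) - L x φ) := by
    rw [intervalIntegral.integral_sub (hc.intervalIntegrable _ _) (by simp),
      intervalIntegral.integral_const, smul_sub, sub_zero, Complex.real_smul, smul_eq_mul,
      smul_eq_mul, ← mul_assoc, inv_mul_cancel₀ htne, one_mul]
  rw [dist_eq_norm, hsub, norm_smul, norm_inv, Complex.norm_real, Real.norm_of_nonneg ht0'.le,
    inv_mul_lt_iff₀ ht0']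
  have hle := intervalIntegral.norm_integral_le_of_norm_le_const (a := (0 : ℝ)) (b := (t : ℝ))
    (f := fun τ : ℝ => L (T.toFun τ.toNNReal x) (T₀.sunSemigroup.toFun (t - τ.toNNReal) φ) - L x φ)
    (C := ε / 2) (fun τ hτ => ?_)
  · rw [sub_zero, abs_of_pos ht0'] at hle
    refine hle.trans_lt ?_
    rw [mul_comm]
    exact mul_lt_mul_of_pos_left (half_lt_self hε) ht0'
  · rw [Set.uIoc_of_le t.coe_nonneg] at hτ
    have hτt : τ.toNNReal ≤ t := Real.toNNReal_le_iff_le_coe.2 hτ.2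
    have hd : ∀ s : ℝ≥0, s ≤ t → dist s 0 < δ := by
      intro s hs
      rw [NNReal.dist_eq] at ht ⊢
      have hs' : (s : ℝ) ≤ t := hs
      simp only [NNReal.coe_zero, sub_zero, abs_of_nonneg, NNReal.coe_nonneg] at ht ⊢
      linarith
    have := hpq (hδ' (hd _ hτt)).1 (hδ' (hd _ (tsub_le_self (a := t) (b := τ.toNNReal)))).2
    rw [dist_eq_norm] at this
    exact this.le

theorem augment_toFun_apply (T₀ : C0Semigroup X) (p : ℕ) (t : ℝ≥0) (x : X) (α : Fin p → ℂ) :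
    (T₀.augment p).toFun t (x, α) = (T₀.toFun t x, α) := rfl

theorem comp_fst_mem_sun_augment (T₀ : C0Semigroup X) (p : ℕ) {φ : StrongDual ℂ X}
    (hφ : φ ∈ T₀.sun) : φ.comp (ContinuousLinearMap.fst ℂ X (Fin p → ℂ)) ∈ (T₀.augment p).sun := by
  have h : Continuous fun t : ℝ≥0 => φ.comp (T₀.toFun t) := hφ
  exact h.clm_comp (continuous_const (y := ContinuousLinearMap.fst ℂ X (Fin p → ℂ)))

theorem comp_snd_mem_sun_augment (T₀ : C0Semigroup X) (p : ℕ) (ψ : StrongDual ℂ (Fin p → ℂ)) :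
    ψ.comp (ContinuousLinearMap.snd ℂ X (Fin p → ℂ)) ∈ (T₀.augment p).sun :=
  continuous_const (y := ψ.comp (ContinuousLinearMap.snd ℂ X (Fin p → ℂ)))

/-- This is `A^{⊙*} = A₀^{⊙*} + L j⁻¹` on `j(X)`: the Duhamel term contributes exactly `L x` to the
difference quotient. -/
theorem IsPerturbation.j_mem_sunStarGenerator_iff {T₀ T : C0Semigroup X}
    {L : X →L[ℂ] T₀.SunStar} (hT : T₀.IsPerturbation L T)
    (h : T.sun = T₀.sun) (x : X) (Ψ : T₀.SunStar) :
    (T.j x, sunStarCast h Ψ) ∈ T.sunStarGenerator ↔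
      (T₀.j x, Ψ - L x) ∈ T₀.sunStarGenerator := by
  rw [j_mem_sunStarGenerator_def, j_mem_sunStarGenerator_def]
  have hsplit : ∀ (φ : T₀.sun) (t : ℝ≥0), ((t : ℝ) : ℂ)⁻¹ • (φ.1 (T.toFun t x) - φ.1 x) =
      ((t : ℝ) : ℂ)⁻¹ • (φ.1 (T₀.toFun t x) - φ.1 x) + ((t : ℝ) : ℂ)⁻¹ • ∫ τ in (0 : ℝ)..t,
        L (T.toFun τ.toNNReal x) (T₀.sunSemigroup.toFun (t - τ.toNNReal) φ) := by
    intro φ t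
    have := hT t x φ
    rw [j_apply, j_apply] at this
    rw [this, ← smul_add]
    congr 1
    ring
  constructor
  · intro H φ
    have h1 := (H ⟨φ.1, h.symm ▸ φ.2⟩).sub (tendsto_inv_smul_duhamel T₀ T L x φ)
    refine h1.congr fun t => ?_
    rw [hsplit φ t, add_sub_cancel_right]
  · intro H φ
    have h1 := (H ⟨φ.1, h ▸ φ.2⟩).add (tendsto_inv_smul_duhamel T₀ T L x ⟨φ.1, h ▸ φ.2⟩)
    rw [sub_apply, sub_add_cancel] at h1
    refine h1.congr fun t => ?_
    rw [← hsplit ⟨φ.1, h ▸ φ.2⟩ t]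

/-- Functionals pulled back from either factor belong to the augmented sun space. Those from `ℂ^p`
see a constant orbit, which forces `β = 0`; those from `X` give the equation for `T₀`. -/
theorem j_augment_mem_sunStarGenerator_iff (T₀ : C0Semigroup X) {p : ℕ} (x y : X)
    (α β : Fin p → ℂ) (Ψ : T₀.SunStar) :
    ((T₀.augment p).j (x, α), (T₀.augment p).j (y, β) - T₀.sunStarInl p Ψ) ∈
      (T₀.augment p).sunStarGenerator ↔
        β = 0 ∧ (T₀.j x, T₀.j y - Ψ) ∈ T₀.sunStarGenerator := by
  rw [j_mem_sunStarGenerator_def, j_mem_sunStarGenerator_def]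
  constructor
  · intro H
    constructor
    · funext i
      have h1 := H ⟨_, T₀.comp_snd_mem_sun_augment p (ContinuousLinearMap.proj i)⟩
      have h2 : T₀.sunFst p ⟨_, T₀.comp_snd_mem_sun_augment p (ContinuousLinearMap.proj i)⟩ = 0 := by
        ext x
        rfl
      have h3 : ((T₀.augment p).j (y, β) - T₀.sunStarInl p Ψ)
          ⟨_, T₀.comp_snd_mem_sun_augment p (ContinuousLinearMap.proj i)⟩ = β i := by
        have h4 : T₀.sunStarInl p Ψ ⟨_, T₀.comp_snd_mem_sun_augment p (ContinuousLinearMap.proj i)⟩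
          = 0 := by
          change Ψ (T₀.sunFst p _) = 0
          rw [h2, map_zero]
        rw [sub_apply, h4, sub_zero]
        rfl
      rw [h3] at h1
      refine tendsto_nhds_unique h1 ?_
      refine tendsto_const_nhds.congr fun t => ?_
      simp [augment_toFun_apply]
    · intro φ
      have h1 := H ⟨_, T₀.comp_fst_mem_sun_augment p φ.2⟩
      exact h1
  · rintro ⟨rfl, H⟩ ψ
    have h1 := H (T₀.sunFst p ψ)
    have hψ : ∀ u : X, (T₀.sunFst p ψ).1 u = ψ.1 (u, 0) := fun u => rfl
    have h2 : ((T₀.augment p).j (y, 0) - T₀.sunStarInl p Ψ) ψ =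
        (T₀.j y - Ψ) (T₀.sunFst p ψ) := rfl
    rw [h2]
    refine h1.congr fun t => ?_
    rw [hψ, hψ, augment_toFun_apply, ← map_sub, ← map_sub]
    simp

end NormedSpace

section Perturbation

variable {X : Type*} [NormedAddCommGroup X] [NormedSpace ℂ X] [CompleteSpace X]
  {T₀ T : C0Semigroup X} {L : X →L[ℂ] T₀.SunStar}

/-- The Duhamel integral has norm of order `t` in `X^{⊙*}`, and `j` is bounded below. Norm closeness
near `0` is what makes `T` and `T₀` share their sun spaces. -/
theorem IsPerturbation.exists_norm_sub_le (hT : T₀.IsPerturbation L T) :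
    ∃ C : ℝ, 0 ≤ C ∧ ∀ t : ℝ≥0, t ≤ 1 → ‖T.toFun t - T₀.toFun t‖ ≤ C * t := by
  obtain ⟨M, hM0, hM⟩ := T.exists_norm_le 1
  obtain ⟨N, hN0, hN⟩ := T₀.sunSemigroup.exists_norm_le 1
  obtain ⟨c, hc0, hc⟩ := T₀.exists_norm_le_norm_j
  refine ⟨c * (‖L‖ * M * N), by positivity, fun t ht => ?_⟩
  refine ContinuousLinearMap.opNorm_le_bound _ (by positivity) fun x => ?_
  refine (hc _).trans ?_
  have key : ‖T₀.j ((T.toFun t - T₀.toFun t) x)‖ ≤ ‖L‖ * M * N * t * ‖x‖ := by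
    refine ContinuousLinearMap.opNorm_le_bound _ (by positivity) fun φ => ?_
    have h1 : T₀.j ((T.toFun t - T₀.toFun t) x) φ = ∫ τ in (0 : ℝ)..t,
        L (T.toFun τ.toNNReal x) (T₀.sunSemigroup.toFun (t - τ.toNNReal) φ) := by
      have := hT t x φ
      rw [sub_apply, map_sub, sub_apply, this, add_sub_cancel_left]
    rw [h1]
    refine (intervalIntegral.norm_integral_le_of_norm_le_const
      (C := ‖L‖ * (M * ‖x‖) * (N * ‖φ‖)) ?_).trans (le_of_eq ?_)
    · intro τ hτ
      rw [Set.uIoc_of_le t.coe_nonneg] at hτ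
      have ht1 : (t : ℝ) ≤ 1 := ht
      refine (ContinuousLinearMap.le_opNorm _ _).trans (mul_le_mul ?_ ?_ (norm_nonneg _)
        (by positivity))
      · refine (L.le_opNorm _).trans (mul_le_mul_of_nonneg_left ?_ (norm_nonneg _))
        refine (T.toFun _).le_of_opNorm_le (hM _ (Real.toNNReal_le_iff_le_coe.2 ?_)) x
        exact hτ.2.trans ht1
      · exact (T₀.sunSemigroup.toFun _).le_of_opNorm_le (hN _ (tsub_le_self.trans ht)) φ
    · rw [sub_zero, abs_of_nonneg t.coe_nonneg]
      ring
  calc c * ‖T₀.j ((T.toFun t - T₀.toFun t) x)‖ ≤ c * (‖L‖ * M * N * t * ‖x‖) :=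
        mul_le_mul_of_nonneg_left key hc0
    _ = c * (‖L‖ * M * N) * t * ‖x‖ := by ring

theorem IsPerturbation.tendsto_sub (hT : T₀.IsPerturbation L T) :
    Tendsto (fun t : ℝ≥0 => T.toFun t - T₀.toFun t) (𝓝 0) (𝓝 0) := by
  obtain ⟨C, hC0, hC⟩ := hT.exists_norm_sub_le
  have hev : ∀ᶠ s in 𝓝 (0 : ℝ≥0), s ≤ 1 := by
    filter_upwards [Iio_mem_nhds (zero_lt_one (α := ℝ≥0))] with s hs using le_of_lt hs
  refine squeeze_zero_norm' (hev.mono hC) ?_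
  have : Continuous fun s : ℝ≥0 => C * (s : ℝ) := by fun_prop
  simpa using this.tendsto 0

theorem IsPerturbation.sun_eq (hT : T₀.IsPerturbation L T) : T.sun = T₀.sun := by
  ext φ
  rw [mem_sun_iff_tendsto, mem_sun_iff_tendsto]
  have h1 : Tendsto (fun t : ℝ≥0 => φ.comp (T.toFun t - T₀.toFun t)) (𝓝 0) (𝓝 0) := by
    have := ((ContinuousLinearMap.compL ℂ X X ℂ φ).continuous.tendsto 0).comp hT.tendsto_sub
    rw [map_zero] at this
    exact this
  constructor
  · intro h
    have := h.sub h1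
    rw [sub_zero] at this
    refine this.congr fun t => ?_
    rw [ContinuousLinearMap.comp_sub, sub_sub_cancel]
  · intro h
    have := h.add h1
    rw [add_zero] at this
    refine this.congr fun t => ?_
    rw [ContinuousLinearMap.comp_sub, add_sub_cancel]

/-- The domain of `A^{⊙*}` lies in the space of strong continuity of `T^{⊙*}`. As `T - T₀` tends to
`0` in norm, `T₀^{⊙*}` is strongly continuous there too, and reflexivity for `T₀` applies. -/
theorem IsPerturbation.exists_j_eq_of_mem_sunStarGenerator (hT : T₀.IsPerturbation L T)
    (hrefl : T₀.IsSunReflexive) {Φ Ψ : T.SunStar} (hΦ : (Φ, Ψ) ∈ T.sunStarGenerator) :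
    ∃ x, T.j x = Φ := by
  have h := hT.sun_eq
  have h1 := T.sunSemigroup.weakStarGenerator_fst_mem_sun hΦ
  rw [mem_sun_iff_tendsto] at h1
  have h2 : sunStarCast h.symm Φ ∈ T₀.sunSun := by
    rw [sunSun, mem_sun_iff_tendsto]
    have h3 := ((sunStarCast h.symm).continuous.tendsto _).comp h1
    have h4 : Tendsto (fun t : ℝ≥0 => (sunStarCast h.symm Φ).comp (T₀.sunSemigroup.toFun t) -
        sunStarCast h.symm (Φ.comp (T.sunSemigroup.toFun t))) (𝓝 0) (𝓝 0) := by
      refine squeeze_zero_norm (a := fun t : ℝ≥0 => ‖Φ‖ * ‖T.toFun t - T₀.toFun t‖) (fun t => ?_) ?_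
      · refine ContinuousLinearMap.opNorm_le_bound _ (by positivity) fun φ => ?_
        let ψ : T.sun := ⟨φ.1, h.symm ▸ φ.2⟩
        let ψ₀ : T.sun := ⟨φ.1.comp (T₀.toFun t), by rw [h]; exact T₀.comp_mem_sun t φ.2⟩
        have h5 : ((sunStarCast h.symm Φ).comp (T₀.sunSemigroup.toFun t) -
            sunStarCast h.symm (Φ.comp (T.sunSemigroup.toFun t))) φ =
            Φ (ψ₀ - T.sunSemigroup.toFun t ψ) := by
          rw [map_sub]; rfl
        have h6 : ‖ψ₀ - T.sunSemigroup.toFun t ψ‖ ≤ ‖φ‖ * ‖T.toFun t - T₀.toFun t‖ := by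
          have h7 : ψ₀.1 - (T.sunSemigroup.toFun t ψ).1 =
              φ.1.comp (T₀.toFun t - T.toFun t) := by
            rw [ContinuousLinearMap.comp_sub]; rfl
          change ‖ψ₀.1 - (T.sunSemigroup.toFun t ψ).1‖ ≤ _
          rw [h7, norm_sub_rev]
          exact ContinuousLinearMap.opNorm_comp_le _ _
        rw [h5]
        refine (Φ.le_opNorm _).trans ?_
        calc ‖Φ‖ * ‖ψ₀ - T.sunSemigroup.toFun t ψ‖ ≤ ‖Φ‖ * (‖φ‖ * ‖T.toFun t - T₀.toFun t‖) :=
              mul_le_mul_of_nonneg_left h6 (norm_nonneg _)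
          _ = ‖Φ‖ * ‖T.toFun t - T₀.toFun t‖ * ‖φ‖ := by ring
      · simpa using hT.tendsto_sub.norm.const_mul ‖Φ‖
    have h5 := h4.add h3
    rw [zero_add] at h5
    exact h5.congr fun t => sub_add_cancel _ _
  obtain ⟨x, hx⟩ := hrefl _ h2
  exact ⟨x, by rw [← sunStarCast_j h, hx, sunStarCast_sunStarCast_symm]⟩

/-- The generator of the augmented semigroup in terms of the weak-star generator of `T^{⊙*}`. -/
theorem mem_generator_augment_iff (hT : T₀.IsPerturbation L T) (h : T.sun = T₀.sun) {p : ℕ}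
    {Lp : (Fin p → ℂ) →L[ℂ] T₀.SunStar} {TT : C0Semigroup (X × (Fin p → ℂ))}
    (hTT : (T₀.augment p).IsPerturbation (T₀.augmentPerturbation L Lp) TT)
    (x y : X) (α β : Fin p → ℂ) :
    ((x, α), (y, β)) ∈ TT.generator ↔
      β = 0 ∧ (T.j x, T.j y - sunStarCast h (Lp α)) ∈ T.sunStarGenerator := by
  rw [mem_generator_iff_j, ← sunStarCast_j hTT.sun_eq (y, β), hTT.j_mem_sunStarGenerator_iff]
  have h1 : T₀.augmentPerturbation L Lp (x, α) = T₀.sunStarInl p (L x + Lp α) := rfl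
  rw [h1, j_augment_mem_sunStarGenerator_iff]
  rw [← sunStarCast_j h y, ← map_sub, hT.j_mem_sunStarGenerator_iff]
  rw [sub_sub, add_comm (Lp α)]

end Perturbation

end C0Semigroup

/-! ### Entire families of Laplace transforms -/

/-- Complex exponential weights applied to a continuous curve integrate to an entire function. -/
theorem differentiable_integral_exp_smul {F : Type*} [NormedAddCommGroup F] [NormedSpace ℂ F]
    [CompleteSpace F] {w : ℝ → F} (hw : Continuous w) (t : ℝ) :
    Differentiable ℂ fun z : ℂ => ∫ s in (0 : ℝ)..t, Complex.exp (-(z * s)) • w s := by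
  intro z₀
  have hd : ∀ (s : ℝ) (z : ℂ), HasDerivAt (fun z : ℂ => Complex.exp (-(z * s)) • w s)
      ((-(s : ℂ) * Complex.exp (-(z * s))) • w s) z := by
    intro s z
    have h1 : HasDerivAt (fun z : ℂ => -(z * (s : ℂ))) (-(1 * (s : ℂ))) z :=
      ((hasDerivAt_id z).mul_const (s : ℂ)).neg
    have h2 := h1.cexp.smul_const (w s)
    rwa [one_mul, mul_comm] at h2
  have hjoint : Continuous fun q : ℂ × ℝ => (-(q.2 : ℂ) * Complex.exp (-(q.1 * q.2))) • w q.2 := by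
    fun_prop
  obtain ⟨C, hC⟩ := ((isCompact_closedBall z₀ 1).prod
    (isCompact_uIcc (a := (0 : ℝ)) (b := t))).exists_bound_of_continuousOn hjoint.continuousOn
  have hc : ∀ z : ℂ, Continuous fun s : ℝ => Complex.exp (-(z * s)) • w s := fun z => by fun_prop
  have hc' : Continuous fun s : ℝ => (-(s : ℂ) * Complex.exp (-(z₀ * s))) • w s := by fun_prop
  exact (intervalIntegral.hasDerivAt_integral_of_dominated_loc_of_deriv_le
    (F := fun (z : ℂ) (s : ℝ) => Complex.exp (-(z * s)) • w s)
    (F' := fun (z : ℂ) (s : ℝ) => (-(s : ℂ) * Complex.exp (-(z * s))) • w s)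
    (bound := fun _ => C) (Metric.ball_mem_nhds z₀ one_pos)
    (Eventually.of_forall fun z => (hc z).aestronglyMeasurable)
    ((hc z₀).intervalIntegrable _ _) hc'.aestronglyMeasurable
    (Eventually.of_forall fun s hs z hz =>
      hC (z, s) ⟨Metric.ball_subset_closedBall hz, Set.uIoc_subset_uIcc hs⟩)
    (by simp) (Eventually.of_forall fun s _ z _ => hd s z)).2.differentiableAt

theorem continuous_of_norm_sub_le {ι F G : Type*} [TopologicalSpace ι] [SeminormedAddCommGroup F]
    [SeminormedAddCommGroup G] {W : ι → F} {V : ι → G} {c : ℝ} (hV : Continuous V)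
    (h : ∀ r s, ‖W r - W s‖ ≤ c * ‖V r - V s‖) : Continuous W := by
  rw [continuous_iff_continuousAt]
  intro s
  rw [ContinuousAt, tendsto_iff_norm_sub_tendsto_zero]
  refine squeeze_zero (fun r => norm_nonneg _) (fun r => h r s) ?_
  have : Continuous fun r => c * ‖V r - V s‖ := by fun_prop
  simpa using this.tendsto s

/-- If every scalar image of the curve `W` has a continuous derivative `a`, then the Laplace
transforms of the functions `a` come from an entire function. -/
theorem exists_entire_of_primitive {F : Type*} [NormedAddCommGroup F] [NormedSpace ℂ F]
    [CompleteSpace F] {W : ℝ → F} (hW : Continuous W) {t : ℝ} (ht : 0 ≤ t) :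
    ∃ S : ℂ → F, Differentiable ℂ S ∧ ∀ (f : F →L[ℂ] ℂ) (a : ℝ → ℂ), Continuous a →
      (∀ s ∈ Set.Icc 0 t, f (W s) = ∫ r in (0 : ℝ)..s, a r) →
      ∀ z, f (S z) = ∫ s in (0 : ℝ)..t, Complex.exp (-(z * s)) • a s := by
  -- Integration by parts: this is `∫₀ᵗ e^{-zs} W'(s) ds` rewritten so that only norm continuity of
  -- `W` is needed, not a norm derivative.
  refine ⟨fun z => Complex.exp (-(z * t)) • W t +
    z • ∫ s in (0 : ℝ)..t, Complex.exp (-(z * s)) • W s, ?_, fun f a ha hfa z => ?_⟩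
  · have h1 := differentiable_integral_exp_smul hW t
    have h2 : Differentiable ℂ fun z : ℂ => Complex.exp (-(z * t)) • W t := by fun_prop
    exact h2.add (differentiable_id.smul h1)
  · have hint : IntervalIntegrable (fun s : ℝ => Complex.exp (-(z * s)) • W s)
        MeasureTheory.volume 0 t := Continuous.intervalIntegrable (by fun_prop) _ _
    rw [map_add, map_smul, map_smul, ← f.intervalIntegral_comp_comm hint]
    simp only [map_smul]
    have hu : ∀ s : ℝ, HasDerivAt (fun s : ℝ => Complex.exp (-(z * s)))
        (-z * Complex.exp (-(z * s))) s := by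
      intro s
      have h1 : HasDerivAt (fun s : ℝ => -(z * (s : ℂ))) (-(z * 1)) s :=
        (((hasDerivAt_id (s : ℂ)).comp_ofReal).const_mul z).neg
      have := h1.cexp
      rwa [mul_one, mul_comm] at this
    have hparts := intervalIntegral.integral_mul_deriv_eq_deriv_mul (a := (0 : ℝ)) (b := t)
      (u := fun s : ℝ => Complex.exp (-(z * s))) (u' := fun s : ℝ => -z * Complex.exp (-(z * s)))
      (v := fun s : ℝ => ∫ r in (0 : ℝ)..s, a r) (v' := a)
      (fun s _ => hu s)
      (fun s _ => intervalIntegral.integral_hasDerivAt_right (ha.intervalIntegrable _ _)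
        ha.aestronglyMeasurable.stronglyMeasurableAtFilter ha.continuousAt)
      (Continuous.intervalIntegrable (by fun_prop) _ _) (ha.intervalIntegrable _ _)
    simp only [smul_eq_mul]
    rw [hparts, hfa t ⟨ht, le_rfl⟩, intervalIntegral.integral_same, mul_zero, sub_zero,
      sub_eq_add_neg, ← intervalIntegral.integral_neg]
    congr 1
    rw [← intervalIntegral.integral_const_mul]
    refine intervalIntegral.integral_congr fun s hs => ?_
    rw [Set.uIcc_of_le ht] at hs
    simp only [hfa s hs]
    ring

theorem MeromorphicAt.clm_comp_analyticAt {E F G : Type*} [NormedAddCommGroup E]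
    [NormedSpace ℂ E] [NormedAddCommGroup F] [NormedSpace ℂ F] [NormedAddCommGroup G]
    [NormedSpace ℂ G] {A : ℂ → F →L[ℂ] G} {B : ℂ → E →L[ℂ] F} {a : ℂ} (hA : MeromorphicAt A a)
    (hB : AnalyticAt ℂ B a) : MeromorphicAt (fun z => (A z).comp (B z)) a := by
  obtain ⟨n, hn⟩ := hA
  exact ⟨n, ((ContinuousLinearMap.compL ℂ E F G).analyticAt_bilinear _).comp
    (AnalyticAt.prod hn hB)⟩

/-! ### The resolvent of the weak-star generator is meromorphic -/

namespace C0Semigroup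

section Resolvent

variable {X : Type*} [NormedAddCommGroup X] [NormedSpace ℂ X] [CompleteSpace X]

theorem exists_lift_j (T₀ : C0Semigroup X) {Y : Type*} [NormedAddCommGroup Y] [NormedSpace ℂ Y]
    (A : Y →L[ℂ] T₀.SunStar) (hA : ∀ y, ∃ x, T₀.j x = A y) :
    ∃ B : Y →L[ℂ] X, ∀ y, T₀.j (B y) = A y := by
  obtain ⟨c, hc0, hc⟩ := T₀.exists_norm_le_norm_j
  choose f hf using hA
  refine ⟨LinearMap.mkContinuousOfExistsBound
    { toFun := f
      map_add' := fun x y => T₀.j_injective (by simp [hf])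
      map_smul' := fun a x => T₀.j_injective (by simp [hf]) } ⟨c * ‖A‖, fun y => ?_⟩, hf⟩
  refine (hc _).trans ?_
  rw [mul_assoc]
  refine mul_le_mul_of_nonneg_left ?_ hc0
  change ‖T₀.j (f y)‖ ≤ _
  rw [hf]
  exact A.le_opNorm y

/-- For a sun-reflexive space the truncated Laplace transform of the weak-star continuous semigroup
on `X^{⊙*}` takes values in `X` and depends holomorphically on the parameter. -/
theorem exists_lift_truncatedLaplace (T₀ : C0Semigroup X) (hrefl : T₀.IsSunReflexive) (t : ℝ≥0) :
    ∃ S : ℂ → T₀.SunStar →L[ℂ] X, Differentiable ℂ S ∧ ∀ z Φ,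
      T₀.j (S z Φ) = Φ.comp (T₀.sunSemigroup.truncatedLaplace z t) := by
  obtain ⟨c, hc0, hc⟩ := T₀.exists_norm_le_norm_j
  -- Smoothing an element of `X^{⊙*}` by the primitive of `T₀^⊙` lands in `X^{⊙⊙}`, so reflexivity
  -- lifts it to `X`.
  have hW : ∀ s : ℝ≥0, ∃ B : T₀.SunStar →L[ℂ] X, ∀ Φ,
      T₀.j (B Φ) = Φ.comp (T₀.sunSemigroup.truncatedLaplace 0 s) := fun s =>
    T₀.exists_lift_j ((ContinuousLinearMap.compL ℂ T₀.sun T₀.sun ℂ).flip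
      (T₀.sunSemigroup.truncatedLaplace 0 s)) fun Φ =>
        hrefl _ (T₀.sunSemigroup.comp_truncatedLaplace_mem_sun Φ s)
  choose W hW using hW
  have hWc : Continuous W := by
    refine continuous_of_norm_sub_le (F := T₀.SunStar →L[ℂ] X) (c := c)
      T₀.sunSemigroup.continuous_truncatedLaplace_zero fun r s => ?_
    refine ContinuousLinearMap.opNorm_le_bound _ (by positivity) fun Φ => ?_
    refine (hc _).trans ?_
    rw [mul_assoc]
    refine mul_le_mul_of_nonneg_left ?_ hc0
    rw [sub_apply, map_sub, hW, hW, ← ContinuousLinearMap.comp_sub, mul_comm]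
    exact ContinuousLinearMap.opNorm_comp_le _ _
  have hentire := exists_entire_of_primitive (F := T₀.SunStar →L[ℂ] X)
    (W := fun s : ℝ => W s.toNNReal) (t := (t : ℝ))
  obtain ⟨S, hSd, hS⟩ := hentire (hWc.comp continuous_real_toNNReal) t.coe_nonneg
  refine ⟨S, hSd, fun z Φ => ?_⟩
  ext φ
  let ev : (T₀.SunStar →L[ℂ] X) →L[ℂ] ℂ := (ContinuousLinearMap.apply ℂ ℂ φ).comp
    (T₀.j.comp (ContinuousLinearMap.apply ℂ X Φ))
  have ha : Continuous fun s : ℝ => Φ (T₀.sunSemigroup.toFun s.toNNReal φ) :=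
    Φ.continuous.comp (T₀.sunSemigroup.continuous_toNNReal_apply φ)
  have h1 := hS ev _ ha (fun s hs => ?_) z
  · rw [ContinuousLinearMap.comp_apply, apply_truncatedLaplace _ Φ z]
    exact h1
  · change T₀.j (W s.toNNReal Φ) φ = _
    rw [hW, ContinuousLinearMap.comp_apply, apply_truncatedLaplace, Real.coe_toNNReal _ hs.1]
    simp

/-- The truncated Laplace transforms tend to `0` along the positive real axis. -/
theorem tendsto_norm_truncatedLaplace {E : Type*} [NormedAddCommGroup E] [NormedSpace ℂ E]
    [CompleteSpace E] (U : C0Semigroup E) (t : ℝ≥0) :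
    Tendsto (fun r : ℝ => ‖U.truncatedLaplace r t‖) atTop (𝓝 0) := by
  obtain ⟨M, hM0, hM⟩ := U.exists_norm_le t
  refine squeeze_zero' (Eventually.of_forall fun r => norm_nonneg _) (g := fun r => M * r⁻¹) ?_
    (by simpa using tendsto_inv_atTop_zero.const_mul M)
  filter_upwards [eventually_gt_atTop 0] with r hr
  refine ContinuousLinearMap.opNorm_le_bound _ (by positivity) fun x => ?_
  rw [truncatedLaplace_apply]
  have h1 := intervalIntegral.norm_integral_le_of_norm_le (a := (0 : ℝ)) (b := (t : ℝ))
    (μ := MeasureTheory.volume)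
    (f := fun s : ℝ => Complex.exp (-((r : ℂ) * s)) • U.toFun s.toNNReal x)
    (g := fun s : ℝ => Real.exp (-r * s) * (M * ‖x‖)) t.coe_nonneg
    (Eventually.of_forall fun s hs => ?_)
    (Continuous.intervalIntegrable (by fun_prop) _ _)
  · refine h1.trans ?_
    rw [intervalIntegral.integral_mul_const,
      intervalIntegral.integral_comp_mul_left (fun x => Real.exp x) (by linarith), integral_exp,
      mul_zero, Real.exp_zero, smul_eq_mul]
    have h2 : (-r)⁻¹ * (Real.exp (-r * t) - 1) ≤ r⁻¹ := by
      have h3 : (-r)⁻¹ * (Real.exp (-r * t) - 1) = r⁻¹ * (1 - Real.exp (-r * t)) := by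
        rw [inv_neg]; ring
      rw [h3]
      refine mul_le_of_le_one_right (by positivity) ?_
      have := Real.exp_pos (-r * t)
      linarith
    calc _ ≤ r⁻¹ * (M * ‖x‖) := mul_le_mul_of_nonneg_right h2 (by positivity)
      _ = M * r⁻¹ * ‖x‖ := by ring
  · rw [norm_smul]
    have h2 : ‖Complex.exp (-((r : ℂ) * s))‖ = Real.exp (-r * s) := by
      rw [Complex.norm_exp]
      simp
    rw [h2]
    exact mul_le_mul_of_nonneg_left ((U.toFun s.toNNReal).le_of_opNorm_le
      (hM _ (Real.toNNReal_le_iff_le_coe.2 hs.2)) x) (Real.exp_pos _).le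

/-- The integrated equation is assumed at the single time `t` and wanted at every `h`. Splitting
`[0, t + h]` at `t` and at `h` shows that the defect `u` at time `h` is fixed by `e^{-zt} T₀(t)`, so
injectivity kills it. -/
theorem mem_sunStarGenerator_of_injective (T₀ : C0Semigroup X) (hrefl : T₀.IsSunReflexive)
    {z : ℂ} {t : ℝ≥0}
    (hinj : Function.Injective (1 - Complex.exp (-(z * (t : ℝ))) • T₀.toFun t : X →L[ℂ] X))
    {w : X} {Θ : T₀.SunStar}
    (hw : T₀.j (w - Complex.exp (-(z * (t : ℝ))) • T₀.toFun t w) =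
      Θ.comp (T₀.sunSemigroup.truncatedLaplace z t)) :
    (T₀.j w, z • T₀.j w - Θ) ∈ T₀.sunStarGenerator := by
  rw [sunStarGenerator, mem_weakStarGenerator_iff _ z]
  intro h φ
  obtain ⟨S, -, hS⟩ := T₀.exists_lift_truncatedLaplace hrefl h
  set V := T₀.sunSemigroup.truncatedLaplace z
  set u := Complex.exp (-(z * (h : ℝ))) • T₀.toFun h w - w + S z Θ with hu
  have hw' : ∀ ψ : T₀.sun, ψ.1 w - Complex.exp (-(z * (t : ℝ))) * ψ.1 (T₀.toFun t w) =
      Θ (V t ψ) := by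
    intro ψ
    have := congrArg (fun F : T₀.SunStar => F ψ) hw
    simpa [j_apply] using this
  have hS' : ∀ ψ : T₀.sun, ψ.1 (S z Θ) = Θ (V h ψ) := fun ψ =>
    congrArg (fun F : T₀.SunStar => F ψ) (hS z Θ)
  have hu0 : u = 0 := by
    apply hinj
    rw [map_zero]
    apply T₀.j_injective
    rw [map_zero]
    ext ψ
    have e1 := hw' ψ
    have e2 := hw' (T₀.sunSemigroup.toFun h ψ)
    have e3 := hS' ψ
    have e4 := hS' (T₀.sunSemigroup.toFun t ψ)
    rw [sunSemigroup_apply, sunSemigroup_apply, truncatedLaplace_toFun_comm] at e2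
    rw [sunSemigroup_apply, truncatedLaplace_toFun_comm] at e4
    have e5 := T₀.sunSemigroup.truncatedLaplace_add z h t ψ
    rw [add_comm h t, T₀.sunSemigroup.truncatedLaplace_add z t h ψ] at e5
    have e6 := congrArg Θ e5
    simp only [map_add, map_smul, smul_eq_mul] at e6
    change ψ.1 (u - Complex.exp (-(z * (t : ℝ))) • T₀.toFun t u) = 0
    rw [hu]
    simp only [map_add, map_sub, map_smul, smul_eq_mul, e3, e4]
    rw [T₀.toFun_comm t h]
    linear_combination Complex.exp (-(z * (h : ℝ))) * e2 - e1 - e6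
  have h1 := hS' φ
  have h2 : φ.1 u = 0 := by rw [hu0, map_zero]
  rw [hu] at h2
  simp only [map_add, map_sub, map_smul, smul_eq_mul] at h2
  have h3 : (z • T₀.j w - Θ - z • T₀.j w) (V h φ) = -Θ (V h φ) := by simp
  rw [h3, ← h1, j_apply, j_apply, sunSemigroup_apply, smul_eq_mul]
  linear_combination h2

/-- Over `[0, t]` the resolvent equation becomes `(1 - D(z)) x = S(z) Φ` with `D` entire and
compact-valued, so `Q = (1 - D)⁻¹ S`. That `Q` solves the unintegrated equation also requires `1 -
e^{-zt} T₀(t)` to be injective. -/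
theorem IsPerturbation.exists_meromorphicAt_isResolventAt {T₀ T : C0Semigroup X}
    {L : X →L[ℂ] T₀.SunStar} (hT : T₀.IsPerturbation L T) (hrefl : T₀.IsSunReflexive)
    (hcomp : T₀.IsEventuallyCompact) (hL : IsCompactOperator L) (a : ℂ) :
    ∃ Q : ℂ → T.SunStar →L[ℂ] X, MeromorphicAt Q a ∧
      ∀ᶠ z in 𝓝[≠] a, IsResolventAt T.sunStarGenerator z (T.j.comp (Q z)) := by
  have h := hT.sun_eq
  obtain ⟨t, ht, htc⟩ : ∃ t : ℝ≥0, 0 < t ∧ IsCompactOperator (T₀.toFun t) := by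
    obtain ⟨s, hs⟩ := hcomp
    -- A strictly positive time is needed for `e^{-rt}` to decay as `r → ∞`; adding `1` preserves
    -- compactness.
    refine ⟨1 + s, by positivity, ?_⟩
    rw [T₀.toFun_add]
    exact hs.clm_comp (T₀.toFun 1)
  obtain ⟨S, hSd, hS⟩ := T₀.exists_lift_truncatedLaplace hrefl t
  obtain ⟨c, hc0, hc⟩ := T₀.exists_norm_le_norm_j
  let D₀ : ℂ → X →L[ℂ] X := fun z => Complex.exp (-(z * (t : ℝ))) • T₀.toFun t
  let D : ℂ → X →L[ℂ] X := fun z => D₀ z + (S z).comp L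
  have hD₀d : Differentiable ℂ D₀ := by
    change Differentiable ℂ fun z : ℂ => Complex.exp (-(z * (t : ℝ))) • T₀.toFun t
    fun_prop
  have hDd : Differentiable ℂ D := hD₀d.add (hSd.clm_comp (differentiable_const L))
  have hD₀c : ∀ z, IsCompactOperator (D₀ z) := fun z => htc.smul _
  have hDc : ∀ z, IsCompactOperator (D z) := fun z => (hD₀c z).add (hL.clm_comp (S z))
  have hunit : ∀ A : X →L[ℂ] X, ‖A‖ < 1 → IsUnit (1 - A : X →L[ℂ] X) := fun A hA => 
    isUnit_one_sub_of_norm_lt_one hA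
  have hD₀lim : Tendsto (fun r : ℝ => ‖D₀ r‖) atTop (𝓝 0) := by
    have h1 : ∀ r : ℝ, ‖D₀ r‖ = Real.exp (-(r * t)) * ‖T₀.toFun t‖ := by
      intro r
      simp only [D₀]
      rw [norm_smul, Complex.norm_exp]
      simp
    simp_rw [h1]
    have h2 : Tendsto (fun r : ℝ => Real.exp (-(r * t))) atTop (𝓝 0) :=
      Real.tendsto_exp_neg_atTop_nhds_zero.comp
        (tendsto_id.atTop_mul_const (by exact_mod_cast ht))
    simpa using h2.mul_const _
  have hSlim : Tendsto (fun r : ℝ => ‖(S r).comp L‖) atTop (𝓝 0) := by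
    have hle : ∀ r : ℝ, ‖(S r).comp L‖ ≤
        c * ‖T₀.sunSemigroup.truncatedLaplace r t‖ * ‖L‖ := by
      intro r
      refine (ContinuousLinearMap.opNorm_comp_le _ _).trans
        (mul_le_mul_of_nonneg_right ?_ (norm_nonneg _))
      refine ContinuousLinearMap.opNorm_le_bound _ (by positivity) fun Φ => ?_
      refine (hc _).trans ?_
      rw [mul_assoc, hS]
      refine mul_le_mul_of_nonneg_left ?_ hc0
      rw [mul_comm]
      exact ContinuousLinearMap.opNorm_comp_le _ _
    refine squeeze_zero (fun r => norm_nonneg _) hle ?_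
    simpa using ((T₀.sunSemigroup.tendsto_norm_truncatedLaplace t).const_mul c).mul_const ‖L‖
  obtain ⟨r₀, hr₀⟩ := (hD₀lim.eventually (gt_mem_nhds one_pos)).exists
  have hDlim : Tendsto (fun r : ℝ => ‖D₀ r‖ + ‖(S r).comp L‖) atTop (𝓝 0) := by
    simpa using hD₀lim.add hSlim
  obtain ⟨r₁, hr₁⟩ := (hDlim.eventually (gt_mem_nhds one_pos)).exists
  -- Fredholm theory is used twice: for `D₀` to obtain injectivity at punctured-near points, then
  -- for `D` to obtain the resolvent itself.
  have hF₀ := (analyticFredholm hD₀d hD₀c (z₁ := (r₀ : ℂ)) (hunit _ hr₀) a).1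
  obtain ⟨hF, hFm⟩ := analyticFredholm hDd hDc (z₁ := (r₁ : ℂ)) (hunit _ ((norm_add_le _ _).trans_lt hr₁)) a
  refine ⟨fun z => (Ring.inverse (1 - D z)).comp ((S z).comp (sunStarCast h.symm)), ?_, ?_⟩
  · exact hFm.clm_comp_analyticAt ((hSd.clm_comp (differentiable_const _)).analyticAt a)
  · filter_upwards [hF₀, hF] with z hz₀ hz
    have hinj := ((ContinuousLinearMap.isUnit_iff_bijective).1 hz₀).1
    have e1 : ∀ x, (1 - D z) (Ring.inverse (1 - D z) x) = x := fun x =>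
      congrArg (fun A : X →L[ℂ] X => A x) (Ring.mul_inverse_cancel _ hz)
    have e2 : ∀ x, Ring.inverse (1 - D z) ((1 - D z) x) = x := fun x =>
      congrArg (fun A : X →L[ℂ] X => A x) (Ring.inverse_mul_cancel _ hz)
    have eD : ∀ x, (1 - D z) x = x - Complex.exp (-(z * (t : ℝ))) • T₀.toFun t x - S z (L x) := by
      intro x
      simp only [D, D₀, sub_apply, add_apply, smul_apply, one_apply_eq_self,
        ContinuousLinearMap.comp_apply]
      abel
    constructor
    · intro Φ
      set Φ₀ := sunStarCast h.symm Φ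
      set w := Ring.inverse (1 - D z) (S z Φ₀) with hw
      have h1 : w - Complex.exp (-(z * (t : ℝ))) • T₀.toFun t w = S z (L w + Φ₀) := by
        have := e1 (S z Φ₀)
        rw [← hw, eD, sub_eq_iff_eq_add] at this
        rw [this, map_add, add_comm]
      have h2 : (T₀.j w, z • T₀.j w - (L w + Φ₀)) ∈ T₀.sunStarGenerator :=
        T₀.mem_sunStarGenerator_of_injective hrefl hinj (by rw [h1, hS])
      have h3 := (hT.j_mem_sunStarGenerator_iff h w (z • T₀.j w - Φ₀)).2
        (by rw [sub_sub, add_comm Φ₀]; exact h2)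
      exact h3
    · intro Φ Ψ hΦ
      obtain ⟨x, rfl⟩ := hT.exists_j_eq_of_mem_sunStarGenerator hrefl hΦ
      set Ψ₀ := sunStarCast h.symm Ψ
      have h1 : (T₀.j x, Ψ₀ - L x) ∈ T₀.sunStarGenerator :=
        (hT.j_mem_sunStarGenerator_iff h x Ψ₀).1 hΦ
      have h2 : S z (z • T₀.j x - (Ψ₀ - L x)) =
          x - Complex.exp (-(z * (t : ℝ))) • T₀.toFun t x := by
        apply T₀.j_injective
        rw [hS]
        ext φ
        have h3 := (mem_weakStarGenerator_iff _ z _ _).1 h1 t φ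
        rw [map_sub, map_smul, sub_apply, smul_apply]
        have h4 : T₀.j (T₀.toFun t x) φ = T₀.j x (T₀.sunSemigroup.toFun t φ) := rfl
        rw [h4, ← neg_sub (Complex.exp _ • _), h3, ContinuousLinearMap.comp_apply, ← neg_apply,
          neg_sub]
      have h5 : sunStarCast h.symm (z • T.j x - Ψ) = z • T₀.j x - Ψ₀ := rfl
      change T.j (Ring.inverse (1 - D z) (S z (sunStarCast h.symm (z • T.j x - Ψ)))) = T.j x
      congr 1
      rw [h5]
      have h6 : S z (z • T₀.j x - Ψ₀) = (1 - D z) x := by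
        rw [eD, ← h2, ← map_sub]
        congr 1
        abel
      rw [h6, e2]

end Resolvent

end C0Semigroup

/-! ### Generalized eigenspaces and Laurent coefficients of the resolvent -/

section KerPow

variable {E : Type*} [NormedAddCommGroup E] [NormedSpace ℂ E]

theorem kerPow_monotone (A : Submodule ℂ (E × E)) (lam : ℂ) : Monotone (kerPow A lam) := by
  refine monotone_nat_of_le_succ fun n => ?_
  induction n with
  | zero => exact bot_le
  | succ n ih =>
    intro x hx
    rw [mem_kerPow_succ] at hx ⊢
    obtain ⟨y, hy, hyx⟩ := hx
    exact ⟨y, hy, ih hyx⟩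

theorem mem_genEigenspace_iff (A : Submodule ℂ (E × E)) (lam : ℂ) (x : E) :
    x ∈ genEigenspace A lam ↔ ∃ n, x ∈ kerPow A lam n :=
  Submodule.mem_iSup_of_directed _ (kerPow_monotone A lam).directed_le

theorem genEigenspace_le_centerEigenspace (A : Submodule ℂ (E × E)) {lam : ℂ} (h : lam.re = 0) :
    genEigenspace A lam ≤ centerEigenspace A :=
  le_iSup₂_of_le lam h le_rfl

theorem mem_centerEigenspace_of_mem_kerPow {A : Submodule ℂ (E × E)} {lam : ℂ} (h : lam.re = 0)
    {n : ℕ} {x : E} (hx : x ∈ kerPow A lam n) : x ∈ centerEigenspace A :=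
  genEigenspace_le_centerEigenspace A h ((mem_genEigenspace_iff A lam x).2 ⟨n, hx⟩)

theorem IsResolventAt.unboundedResolvent_eq {A : Submodule ℂ (E × E)} {z : ℂ} {R : E →L[ℂ] E}
    (h : IsResolventAt A z R) : unboundedResolvent A z = R := by
  have hz : z ∈ unboundedResolventSet A := ⟨R, h⟩
  rw [unboundedResolvent, dif_pos hz]
  ext y
  have := hz.choose_spec.2 _ _ (h.1 y)
  rwa [sub_sub_cancel] at this

end KerPow

theorem ContinuousLinearMap.circleIntegral_comp_comm {F G : Type*} [NormedAddCommGroup F]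
    [NormedSpace ℂ F] [CompleteSpace F] [NormedAddCommGroup G] [NormedSpace ℂ G] [CompleteSpace G]
    (Λ : F →L[ℂ] G) {f : ℂ → F} {c : ℂ} {r : ℝ} (hf : CircleIntegrable f c r) :
    (∮ z in C(c, r), Λ (f z)) = Λ (∮ z in C(c, r), f z) := by
  rw [circleIntegral, circleIntegral, ← Λ.intervalIntegral_comp_comm hf.out]
  simp only [map_smul]

section Laurent

variable {X Y : Type*} [NormedAddCommGroup X] [NormedSpace ℂ X] [CompleteSpace X]
  [NormedAddCommGroup Y] [NormedSpace ℂ Y]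

/-- The constant Laurent coefficient `G` and the preceding one `P` of `z ↦ z⁻ᴺ K(z)`, when this is
a resolvent of the closed operator with graph `B`, up to the polar part carried by `k`. -/
theorem exists_laurent_coefficients {j : X →L[ℂ] Y} {B : Submodule ℂ (Y × Y)}
    (hB : IsClosed (B : Set (Y × Y))) {A : Submodule ℂ (X × X)}
    (hA : ∀ x y, (x, y) ∈ A ↔ (j x, j y) ∈ B) {ρ : ℝ} (hρ : 0 < ρ) (N : ℕ) {K : ℂ → Y →L[ℂ] X}
    (hK : DifferentiableOn ℂ K (Metric.ball 0 ρ)) {k : Y →L[ℂ] X} {m : ℕ}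
    (hKB : ∀ z ∈ Metric.ball (0 : ℂ) ρ, z ≠ 0 → ∀ Φ,
      (j (K z Φ), z • j (K z Φ) + j (k Φ) - z ^ N • Φ) ∈ B)
    (hk : ∀ Φ, k Φ ∈ kerPow A 0 m) :
    ∃ (G P : Y →L[ℂ] X) (n : ℕ), (∀ Φ, (j (G Φ), j (P Φ) - Φ) ∈ B) ∧
      (∀ Φ, P Φ ∈ kerPow A 0 n) ∧ ∀ r, 0 < r → r < ρ →
        (∮ z in C(0, r), (z ^ (N + 1))⁻¹ • K z) = (2 * (Real.pi : ℂ) * Complex.I) • G := by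
  have hnhds : Metric.ball (0 : ℂ) ρ ∈ 𝓝 0 := Metric.ball_mem_nhds 0 hρ
  have hKc : ContinuousAt K 0 := (hK.continuousOn).continuousAt hnhds
  -- Let `z → 0` in the closed graph. The factor `0 ^ N` is `1` for `N = 0` and `0` otherwise, so
  -- `Φ` enters only at the last stage of the recursion.
  have hlim : ∀ Φ, (j (K 0 Φ), j (k Φ) - (0 : ℂ) ^ N • Φ) ∈ B := by
    intro Φ
    have hev : ∀ᶠ z in 𝓝[≠] (0 : ℂ),
        (j (K z Φ), z • j (K z Φ) + j (k Φ) - z ^ N • Φ) ∈ (B : Set (Y × Y)) := by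
      filter_upwards [nhdsWithin_le_nhds hnhds, self_mem_nhdsWithin] with z hz hz0
      exact hKB z hz hz0 Φ
    have h1 : ContinuousAt (fun z => j (K z Φ)) 0 :=
      j.continuous.continuousAt.comp (hKc.clm_apply continuousAt_const)
    have h2 : ContinuousAt (fun z : ℂ => (j (K z Φ), z • j (K z Φ) + j (k Φ) - z ^ N • Φ)) 0 :=
      h1.prodMk (((continuousAt_id.smul h1).add continuousAt_const).sub
        ((continuousAt_id.pow N).smul continuousAt_const))
    have h3 := hB.mem_of_tendsto (h2.tendsto.mono_left nhdsWithin_le_nhds) hev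
    simpa using h3
  -- Each stage peels off one polar coefficient: `k` is replaced by `K 0` and `K` by `(K - K 0) /
  -- z`. At `N = 0`, `K 0` is the constant coefficient `G` and `k` is the coefficient `P` of `z⁻¹`.
  induction N generalizing K k m with
  | zero =>
    refine ⟨K 0, k, m, by simpa using hlim, hk, fun r hr hrρ => ?_⟩
    have hd : DifferentiableOn ℂ K (Metric.closedBall 0 r) :=
      hK.mono (Metric.closedBall_subset_ball hrρ)
    have := hd.circleIntegral_sub_inv_smul (Metric.mem_ball_self hr)
    simpa using this
  | succ N ih =>
    have hlim0 : ∀ Φ, (j (K 0 Φ), j (k Φ)) ∈ B := fun Φ => by simpa using hlim Φ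
    have hK' : DifferentiableOn ℂ (dslope K 0) (Metric.ball 0 ρ) :=
      (Complex.differentiableOn_dslope hnhds).2 hK
    have hsl : ∀ z, K z = K 0 + z • dslope K 0 z := by
      intro z
      have := sub_smul_dslope K 0 z
      rw [sub_zero] at this
      rw [this]; abel
    -- The operator sends `K 0 Φ` to the previous coefficient `k Φ`, so the nilpotency order grows
    -- by one.
    have hk' : ∀ Φ, K 0 Φ ∈ kerPow A 0 (m + 1) := by
      intro Φ
      rw [mem_kerPow_succ]
      exact ⟨k Φ, (hA _ _).2 (hlim0 Φ), by simpa using hk Φ⟩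
    have hKB' : ∀ z ∈ Metric.ball (0 : ℂ) ρ, z ≠ 0 → ∀ Φ,
        (j (dslope K 0 z Φ), z • j (dslope K 0 z Φ) + j (K 0 Φ) - z ^ N • Φ) ∈ B := by
      intro z hz hz0 Φ
      have h1 := B.smul_mem z⁻¹ (B.sub_mem (hKB z hz hz0 Φ) (hlim0 Φ))
      have h2 : K z Φ = K 0 Φ + z • dslope K 0 z Φ := by
        conv_lhs => rw [hsl z]
        rfl
      convert h1 using 1
      rw [Prod.mk_sub_mk, Prod.smul_mk]
      congr 1
      · rw [h2, map_add, add_sub_cancel_left, map_smul, inv_smul_smul₀ hz0]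
      · have h3 : z • j (K z Φ) + j (k Φ) - z ^ (N + 1) • Φ - j (k Φ) =
            z • (j (K z Φ) - z ^ N • Φ) := by
          rw [smul_sub, smul_smul, ← pow_succ']
          abel
        rw [h3, inv_smul_smul₀ hz0, h2, map_add, map_smul]
        abel
    have hlim' : ∀ Φ, (j (dslope K 0 0 Φ), j (K 0 Φ) - (0 : ℂ) ^ N • Φ) ∈ B := by
      intro Φ
      have hKc' : ContinuousAt (dslope K 0) 0 := hK'.continuousOn.continuousAt hnhds
      have hev : ∀ᶠ z in 𝓝[≠] (0 : ℂ), (j (dslope K 0 z Φ),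
          z • j (dslope K 0 z Φ) + j (K 0 Φ) - z ^ N • Φ) ∈ (B : Set (Y × Y)) := by
        filter_upwards [nhdsWithin_le_nhds hnhds, self_mem_nhdsWithin] with z hz hz0
        exact hKB' z hz hz0 Φ
      have h1 : ContinuousAt (fun z => j (dslope K 0 z Φ)) 0 :=
        j.continuous.continuousAt.comp (hKc'.clm_apply continuousAt_const)
      have h2 : ContinuousAt (fun z : ℂ => (j (dslope K 0 z Φ),
          z • j (dslope K 0 z Φ) + j (K 0 Φ) - z ^ N • Φ)) 0 :=
        h1.prodMk (((continuousAt_id.smul h1).add continuousAt_const).sub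
          ((continuousAt_id.pow N).smul continuousAt_const))
      have h3 := hB.mem_of_tendsto (h2.tendsto.mono_left nhdsWithin_le_nhds) hev
      simpa using h3
    obtain ⟨G, P, n, hG, hP, hint⟩ := ih hK' hKB' hk'
      (hK'.continuousOn.continuousAt hnhds) hlim'
    refine ⟨G, P, n, hG, hP, fun r hr hrρ => ?_⟩
    rw [← hint r hr hrρ]
    have hne : ∀ z ∈ Metric.sphere (0 : ℂ) r, z ≠ 0 := fun z hz h0 => by
      rw [h0, mem_sphere_zero_iff_norm, norm_zero] at hz
      exact hr.ne hz
    have hcont : ∀ M : ℕ, ContinuousOn (fun z : ℂ => (z ^ M)⁻¹) (Metric.sphere 0 r) := fun M =>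
      (continuousOn_id.pow M).inv₀ fun z hz => pow_ne_zero _ (hne z hz)
    have hsub : Metric.sphere (0 : ℂ) r ⊆ Metric.ball 0 ρ :=
      Metric.sphere_subset_closedBall.trans (Metric.closedBall_subset_ball hrρ)
    have h1 : CircleIntegrable (fun z : ℂ => (z ^ (N + 2))⁻¹ • K 0) 0 r :=
      ContinuousOn.circleIntegrable hr.le ((hcont _).smul continuousOn_const)
    have h2 : CircleIntegrable (fun z : ℂ => (z ^ (N + 1))⁻¹ • dslope K 0 z) 0 r :=
      ContinuousOn.circleIntegrable hr.le ((hcont _).smul (hK'.continuousOn.mono hsub))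
    -- The exponent is at most `-2`, so the peeled-off term has no residue and both integrals agree.
    have h3 : (∮ z in C(0, r), (z ^ (N + 2))⁻¹ • K 0) = 0 := by
      rw [circleIntegral.integral_smul_const]
      have h4 := circleIntegral.integral_sub_zpow_of_ne (n := -((N : ℤ) + 2)) (by omega) 0 0 r
      have h5 : ∀ z : ℂ, (z - 0) ^ (-((N : ℤ) + 2)) = (z ^ (N + 2))⁻¹ := by
        intro z
        rw [sub_zero, zpow_neg]
        norm_cast
      simp_rw [h5] at h4
      rw [h4, zero_smul]
    rw [← zero_add (∮ z in C(0, r), (z ^ (N + 1))⁻¹ • dslope K 0 z), ← h3,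
      ← circleIntegral.integral_add h1 h2]
    refine circleIntegral.integral_congr hr.le fun z hz => ?_
    have hz0 := hne z hz
    rw [hsl z, smul_add, smul_smul]
    congr 2
    rw [pow_succ z (N + 1), mul_inv, mul_assoc, inv_mul_cancel₀ hz0, mul_one]

/-- Multiplying by `z ^ N` removes the pole; the recursion on Laurent coefficients then starts from
`k = 0` in the trivial kernel. -/
theorem exists_hasResidueAt [CompleteSpace Y] {j : X →L[ℂ] Y} {B : Submodule ℂ (Y × Y)}
    (hB : IsClosed (B : Set (Y × Y))) {A : Submodule ℂ (X × X)}
    (hA : ∀ x y, (x, y) ∈ A ↔ (j x, j y) ∈ B) {Q : ℂ → Y →L[ℂ] X} (hQ : MeromorphicAt Q 0)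
    (hQB : ∀ᶠ z in 𝓝[≠] (0 : ℂ), IsResolventAt B z (j.comp (Q z))) :
    ∃ (G P : Y →L[ℂ] X) (n : ℕ),
      HasResidueAt (fun z => z⁻¹ • unboundedResolvent B z) 0 (j.comp G) ∧
      (∀ Φ, (j (G Φ), j (P Φ) - Φ) ∈ B) ∧ ∀ Φ, P Φ ∈ kerPow A 0 n := by
  obtain ⟨N, hN⟩ := hQ
  simp only [sub_zero] at hN
  set K : ℂ → Y →L[ℂ] X := fun z => z ^ N • Q z with hKdef
  rw [eventually_nhdsWithin_iff] at hQB
  obtain ⟨ρ, hρ, hball⟩ := Metric.eventually_nhds_iff_ball.1 (hQB.and hN.eventually_analyticAt)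
  have hK : DifferentiableOn ℂ K (Metric.ball 0 ρ) := fun z hz =>
    (hball z hz).2.differentiableAt.differentiableWithinAt
  have hres : ∀ z ∈ Metric.ball (0 : ℂ) ρ, z ≠ 0 → IsResolventAt B z (j.comp (Q z)) :=
    fun z hz hz0 => (hball z hz).1 hz0
  obtain ⟨G, P, n, hG, hP, hint⟩ := exists_laurent_coefficients hB hA hρ N hK (k := 0) (m := 0)
    (fun z hz hz0 Φ => by
      have h1 := B.smul_mem (z ^ N) ((hres z hz hz0).1 Φ)
      rw [Prod.smul_mk, smul_sub, smul_comm (z ^ N) z] at h1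
      simpa [hKdef] using h1)
    (fun Φ => by simp)
  have heq : ∀ z ∈ Metric.ball (0 : ℂ) ρ, z ≠ 0 → z⁻¹ • unboundedResolvent B z =
      ContinuousLinearMap.compL ℂ Y X Y j ((z ^ (N + 1))⁻¹ • K z) := by
    intro z hz hz0
    rw [(hres z hz hz0).unboundedResolvent_eq, map_smul, hKdef]
    simp only
    rw [map_smul, smul_smul, pow_succ, mul_inv, mul_right_comm,
      inv_mul_cancel₀ (pow_ne_zero _ hz0), one_mul]
    rfl
  refine ⟨G, P, n, ⟨ρ, hρ, ?_, fun r hr hrρ => ?_⟩, hG, hP⟩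
  · refine DifferentiableOn.congr (f := fun z =>
      ContinuousLinearMap.compL ℂ Y X Y j ((z ^ (N + 1))⁻¹ • K z)) ?_ fun z hz => heq z hz.1 hz.2
    have h1 : DifferentiableOn ℂ (fun z : ℂ => (z ^ (N + 1))⁻¹ • K z) (Metric.ball 0 ρ \ {0}) := by
      have h0 : DifferentiableOn ℂ (fun z : ℂ => (z ^ (N + 1))⁻¹) (Metric.ball 0 ρ \ {0}) :=
        (differentiableOn_id.pow _).inv fun z hz => pow_ne_zero _ hz.2
      exact h0.fun_smul (hK.mono Set.sdiff_subset)
    exact (ContinuousLinearMap.compL ℂ Y X Y j).differentiable.comp_differentiableOn h1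
  · have hne : ∀ z ∈ Metric.sphere (0 : ℂ) r, z ≠ 0 := fun z hz h0 => by
      rw [h0, mem_sphere_zero_iff_norm, norm_zero] at hz
      exact hr.ne hz
    have hsub : Metric.sphere (0 : ℂ) r ⊆ Metric.ball 0 ρ :=
      Metric.sphere_subset_closedBall.trans (Metric.closedBall_subset_ball hrρ)
    have hci : CircleIntegrable (fun z : ℂ => (z ^ (N + 1))⁻¹ • K z) 0 r := by
      have hc : ContinuousOn (fun z : ℂ => (z ^ (N + 1))⁻¹) (Metric.sphere 0 r) :=
        (continuousOn_id.pow _).inv₀ fun z hz => pow_ne_zero _ (hne z hz)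
      exact ContinuousOn.circleIntegrable hr.le (hc.smul (hK.continuousOn.mono hsub))
    rw [circleIntegral.integral_congr hr.le fun z hz => heq z (hsub hz) (hne z hz),
      ContinuousLinearMap.circleIntegral_comp_comm _ hci, hint r hr hrρ, map_smul, smul_smul,
      inv_mul_cancel₀ Complex.two_pi_I_ne_zero, one_smul]
    rfl

end Laurent

/-! ### Center eigenspace of a block triangular operator -/

section Center

variable {X Y W : Type*} [NormedAddCommGroup X] [NormedSpace ℂ X]
  [NormedAddCommGroup Y] [NormedSpace ℂ Y] [NormedAddCommGroup W] [NormedSpace ℂ W]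
  {j : X →L[ℂ] Y} {B : Submodule ℂ (Y × Y)} {A : Submodule ℂ (X × X)}
  {AA : Submodule ℂ ((X × W) × (X × W))} {l : W →ₗ[ℂ] Y}

theorem mk_zero_mem_kerPow_iff (hA : ∀ x y, (x, y) ∈ A ↔ (j x, j y) ∈ B)
    (hAA : ∀ x y α β, ((x, α), (y, β)) ∈ AA ↔ β = 0 ∧ (j x, j y - l α) ∈ B) (lam : ℂ) (n : ℕ)
    (x : X) : (x, (0 : W)) ∈ kerPow AA lam n ↔ x ∈ kerPow A lam n := by
  induction n generalizing x with
  | zero => simp [kerPow]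
  | succ n ih =>
    rw [mem_kerPow_succ, mem_kerPow_succ]
    constructor
    · rintro ⟨⟨y, β⟩, h1, h2⟩
      obtain ⟨rfl, h3⟩ := (hAA _ _ _ _).1 h1
      refine ⟨y, (hA _ _).2 (by simpa using h3), (ih _).1 ?_⟩
      simpa using h2
    · rintro ⟨y, h1, h2⟩
      refine ⟨(y, 0), (hAA _ _ _ _).2 ⟨rfl, by simpa using (hA _ _).1 h1⟩, ?_⟩
      simpa using (ih _).2 h2

/-- On second components `AA - λ` acts as `-λ`, which is injective for `λ ≠ 0`. -/
theorem snd_eq_zero_of_mem_kerPow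
    (hAA : ∀ x y α β, ((x, α), (y, β)) ∈ AA ↔ β = 0 ∧ (j x, j y - l α) ∈ B) {lam : ℂ}
    (hlam : lam ≠ 0) (n : ℕ) {x : X} {α : W} (h : (x, α) ∈ kerPow AA lam n) : α = 0 := by
  induction n generalizing x α with
  | zero =>
    have : (x, α) = 0 := h
    exact (Prod.mk_eq_zero.1 this).2
  | succ n ih =>
    rw [mem_kerPow_succ] at h
    obtain ⟨⟨y, β⟩, h1, h2⟩ := h
    obtain ⟨rfl, h3⟩ := (hAA _ _ _ _).1 h1
    rw [Prod.smul_mk, Prod.mk_sub_mk] at h2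
    have := ih h2
    simpa [hlam] using this

/-- `AA` sends `(g α, α)` to `(π α, 0)`, already a generalized null vector, so `(g α, α)` is one as
well. These vectors supply every `α` at `λ = 0`, and any other generalized null vector differs from
one of them by an element with zero second component. -/
theorem centerEigenspace_augment_eq (hA : ∀ x y, (x, y) ∈ A ↔ (j x, j y) ∈ B)
    (hAA : ∀ x y α β, ((x, α), (y, β)) ∈ AA ↔ β = 0 ∧ (j x, j y - l α) ∈ B)
    {g π : W →ₗ[ℂ] X} {m : ℕ} (hg : ∀ α, (j (g α), j (π α) - l α) ∈ B)
    (hπ : ∀ α, π α ∈ kerPow A 0 m) :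
    centerEigenspace AA = (centerEigenspace A).prod ⊥ ⊔ LinearMap.range (g.prod LinearMap.id) := by
  have hgk : ∀ α, (g α, α) ∈ kerPow AA 0 (m + 1) := by
    intro α
    rw [mem_kerPow_succ]
    refine ⟨(π α, 0), (hAA _ _ _ _).2 ⟨rfl, hg α⟩, ?_⟩
    simpa using (mk_zero_mem_kerPow_iff hA hAA 0 m _).2 (hπ α)
  apply le_antisymm
  · refine iSup₂_le fun lam hlam => ?_
    rintro ⟨x, α⟩ hx
    obtain ⟨n, hn⟩ := (mem_genEigenspace_iff _ _ _).1 hx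
    by_cases h0 : lam = 0
    · subst h0
      have h1 : (x - g α, (0 : W)) ∈ kerPow AA 0 (max n (m + 1)) := by
        have := Submodule.sub_mem _ (kerPow_monotone AA 0 (le_max_left n (m + 1)) hn)
          (kerPow_monotone AA 0 (le_max_right n (m + 1)) (hgk α))
        simpa using this
      have h2 := (mk_zero_mem_kerPow_iff hA hAA 0 _ _).1 h1
      refine Submodule.mem_sup.2 ⟨(x - g α, 0),
        ⟨mem_centerEigenspace_of_mem_kerPow hlam h2, rfl⟩, (g α, α), ⟨α, rfl⟩, by simp⟩
    · obtain rfl := snd_eq_zero_of_mem_kerPow hAA h0 n hn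
      have h2 := (mk_zero_mem_kerPow_iff hA hAA lam _ _).1 hn
      exact Submodule.mem_sup_left ⟨mem_centerEigenspace_of_mem_kerPow hlam h2, rfl⟩
  · refine sup_le ?_ ?_
    · have h1 : centerEigenspace A ≤ (centerEigenspace AA).comap (LinearMap.inl ℂ X W) := by
        refine iSup₂_le fun lam hlam x hx => ?_
        obtain ⟨n, hn⟩ := (mem_genEigenspace_iff _ _ _).1 hx
        exact mem_centerEigenspace_of_mem_kerPow hlam ((mk_zero_mem_kerPow_iff hA hAA lam n x).2 hn)
      rintro ⟨x, α⟩ ⟨hx, hα⟩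
      have hα' : α = 0 := hα
      subst hα'
      exact h1 hx
    · rintro _ ⟨α, rfl⟩
      exact mem_centerEigenspace_of_mem_kerPow Complex.zero_re (hgk α)

end Center

/-! ### Direct sum, dimension count and the main theorem -/

theorem Submodule.disjoint_prod_bot_range {R M N : Type*} [Ring R] [AddCommGroup M] [Module R M]
    [AddCommGroup N] [Module R N] (U : Submodule R M) (g : N →ₗ[R] M) :
    Disjoint (U.prod (⊥ : Submodule R N)) (LinearMap.range (g.prod LinearMap.id)) := by
  rw [Submodule.disjoint_def]
  rintro _ ⟨-, h⟩ ⟨α, rfl⟩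
  have hα : α = 0 := h
  simp [hα]

theorem Submodule.rank_prod_bot_sup_range {M : Type*} [AddCommGroup M] [Module ℂ M] {p : ℕ}
    (U : Submodule ℂ M) (g : (Fin p → ℂ) →ₗ[ℂ] M) :
    Module.rank ℂ (U.prod (⊥ : Submodule ℂ (Fin p → ℂ)) ⊔
      LinearMap.range (g.prod LinearMap.id) : Submodule ℂ (M × (Fin p → ℂ))) =
      Module.rank ℂ U + p := by
  have h := Submodule.rank_sup_add_rank_inf_eq (U.prod (⊥ : Submodule ℂ (Fin p → ℂ)))
    (LinearMap.range (g.prod LinearMap.id))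
  rw [(disjoint_prod_bot_range U g).eq_bot, rank_bot, add_zero] at h
  rw [h]
  congr 1
  · have h1 : U.prod (⊥ : Submodule ℂ (Fin p → ℂ)) = U.map (LinearMap.inl ℂ M (Fin p → ℂ)) := by
      ext ⟨x, α⟩
      simp
    rw [h1]
    exact (LinearEquiv.rank_eq (Submodule.equivMapOfInjective _ LinearMap.inl_injective U)).symm
  · have hinj : Function.Injective (g.prod (LinearMap.id (R := ℂ) (M := Fin p → ℂ))) :=
      fun a b hab => congrArg Prod.snd hab
    have h2 := (LinearEquiv.ofInjective _ hinj).lift_rank_eq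
    rw [rank_fin_fun] at h2
    simpa using h2.symm

theorem corollary3p6 {X : Type*} [NormedAddCommGroup X] [NormedSpace ℂ X] [CompleteSpace X]
    (T₀ : C0Semigroup X) (hrefl : T₀.IsSunReflexive) (hcomp : T₀.IsEventuallyCompact)
    (L : X →L[ℂ] T₀.SunStar) (hL : IsCompactOperator L)
    {p : ℕ} (Lp : (Fin p → ℂ) →L[ℂ] T₀.SunStar)
    -- `T` is `T₀` perturbed by `L`, and `TT` is `diag (T₀, I_p)` perturbed by `(L, L_p; 0, 0)`
    (T : C0Semigroup X) (hT : T₀.IsPerturbation L T)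
    (TT : C0Semigroup (X × (Fin p → ℂ)))
    (hTT : (T₀.augment p).IsPerturbation (T₀.augmentPerturbation L Lp) TT) :
    -- `T` and `T₀` have the same sun space, so `L_p` takes values where `A^{⊙*}` acts
    ∃ hsun : T.sun = T₀.sun,
      -- `0` is not an accumulation point of the spectrum of `A^{⊙*}`
      (∀ᶠ z in 𝓝[≠] (0 : ℂ), z ∈ unboundedResolventSet T.sunStarGenerator) ∧
      -- `Γ₀` is the residue at `0` of `z⁻¹ R_z(A^{⊙*})`, and `jΓ₀ = j⁻¹ Γ₀`
      ∃ (Γ₀ : T.SunStar →L[ℂ] T.SunStar) (jΓ₀ : T.SunStar →L[ℂ] X),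
        HasResidueAt (fun z => z⁻¹ • unboundedResolvent T.sunStarGenerator z) 0 Γ₀ ∧
        (∀ Φ, T.j (jΓ₀ Φ) = Γ₀ Φ) ∧
        centerEigenspace TT.generator =
          (centerEigenspace T.generator).prod ⊥ ⊔
            LinearMap.range (LinearMap.prod
              (jΓ₀ ∘L C0Semigroup.sunStarCast hsun ∘L Lp).toLinearMap LinearMap.id) ∧
        Disjoint ((centerEigenspace T.generator).prod (⊥ : Submodule ℂ (Fin p → ℂ)))
          (LinearMap.range (LinearMap.prod
              (jΓ₀ ∘L C0Semigroup.sunStarCast hsun ∘L Lp).toLinearMap LinearMap.id)) ∧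
        Module.rank ℂ (centerEigenspace TT.generator) =
          Module.rank ℂ (centerEigenspace T.generator) + p := by
  have hsun := hT.sun_eq
  obtain ⟨Q, hQ, hQB⟩ := hT.exists_meromorphicAt_isResolventAt hrefl hcomp hL 0
  have hA := T.mem_generator_iff_j
  obtain ⟨G, P, n, hres, hG, hP⟩ := exists_hasResidueAt
    T.sunSemigroup.isClosed_weakStarGenerator hA hQ hQB
  have hAA := fun x y α β => C0Semigroup.mem_generator_augment_iff hT hsun hTT x y α β
  have hc := centerEigenspace_augment_eq hA
    (l := (C0Semigroup.sunStarCast hsun ∘L Lp).toLinearMap) hAA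
    (g := (G ∘L C0Semigroup.sunStarCast hsun ∘L Lp).toLinearMap)
    (π := (P ∘L C0Semigroup.sunStarCast hsun ∘L Lp).toLinearMap) (fun α => hG _) (fun α => hP _)
  -- The Laurent coefficient `G` already takes values in `X`, so it serves as `j⁻¹ Γ₀` and `Γ₀` is
  -- its image under `j`.
  refine ⟨hsun, hQB.mono fun z hz => ⟨_, hz⟩, T.j.comp G, G, hres, fun _ => rfl, hc,
    Submodule.disjoint_prod_bot_range _ _, ?_⟩
  rw [hc]
  exact Submodule.rank_prod_bot_sup_range _ _
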